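/- Let $n,d\ge 0$, let $\mathbf P(n)=\mathbb F_2[x_1,\dots,x_n]$ and let $\mathbf P^d(n)$ be its subspace of homogeneous polynomials of degree $d$. The Steenrod squares $\mathrm{Sq}^k$ ($k\ge 0$) are the linear operators on $\mathbf P(n)$ determined by $\mathrm{Sq}^0=\mathrm{id}$, $\mathrm{Sq}^1(x_i)=x_i^2$, $\mathrm{Sq}^k(x_i)=0$ for $k>1$, $\mathrm{Sq}^k(1)=0$ for $k>0$ and the Cartan formula $\mathrm{Sq}^k(fg)=\sum_{i=0}^k\mathrm{Sq}^i(f)\,\mathrm{Sq}^{k-i}(g)$. A polynomial is hit if it is a finite sum $\sum_{k>0}\mathrm{Sq}^k(g_k)$, and $\mathbf Q^d(n)$ (the cohits) is the quotient of $\mathbf P^d(n)$ by the hit polynomials in it. The block of a monomial $x_1^{d_1}\cdots x_n^{d_n}$ is the $(0,1)$-array $F$ with $n$ rows whose $i$-th row is the reversed binary expansion of $d_i$ (continued by zeros). Its $\omega$-vector $\omega(F)=(\omega_1,\omega_2,\dots)$ is the vector of column sums, and it is descending if $\omega_j\ge\omega_{j+1}$ for all $j\ge 1$. The block $F$ is semistandard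 if for each $1\le r\le n$ the array $F[r]$ of its first $r$ rows has a descending $\omega$-vector. The column-position array $\mathrm{cp}(F)$ has as its $j$-th column the list, in increasing order, of the positions (in $\{1,\dots,n\}$) of the rows of $F$ with a digit $1$ in column $j$, followed by zeros. The degree $d$ is row-regular for $n$ if $d=\sum_{i=1}^n(2^{\lambda_i}-1)$ for some integers $\lambda_1>\cdots>\lambda_n\ge 0$. Theorem. (a) If $d$ is row-regular for $n$, then there is exactly one descending vector that is the $\omega$-vector of a monomial in $\mathbf P^d(n)$. (b) Suppose that exactly one descending vector $\omega$ is the $\omega$-vector of a monomial in $\mathbf P^d(n)$. Then $\mathbf Q^d(n)$ is spanned over $\mathbb F_2$ by the classes of the monomials of degree $d$ whose blocks are semistandard. Moreover, if $\mu$ is the Ferrers diagram whose $j$-th column has length $\omega_j$, then $F\mapsto\mathrm{cp}(F)$ is a bijection from the semistandard blocks of degree $d$ to the (finitely many) semistandard Young tableaux of shape $\mu$ with entries in $\{1,\dots,n\}$, so that $\dim_{\mathbb F_2}\mathbf Q^d(n)$ is at most the number of these tableaux. -/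

import Mathlib

namespace HitProblem

/-- The polynomial algebra `F₂[x₁, …, xₙ]`; the variable `x_{i+1}` is `X i` for `i : Fin n`. -/
abbrev P (n : ℕ) : Type := MvPolynomial (Fin n) (ZMod 2)

/-- The homogeneous polynomials of degree `d`. -/
abbrev homog (n d : ℕ) : Submodule (ZMod 2) (P n) :=
  MvPolynomial.homogeneousSubmodule (Fin n) (ZMod 2) d

/-- The total Steenrod square `SQ = ∑ₖ Sqᵏ tᵏ`, with a variable `t` that records the grading:
the algebra homomorphism with `SQ(xᵢ) = xᵢ + xᵢ² t`. -/
noncomputable def totalSq (n : ℕ) : P n →ₐ[ZMod 2] Polynomial (P n) :=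
  MvPolynomial.aeval fun i =>
    Polynomial.C (MvPolynomial.X i) + Polynomial.C (MvPolynomial.X i ^ 2) * Polynomial.X

/-- The Steenrod square `Sqᵏ` on polynomials: the coefficient of `tᵏ` in the total square. -/
noncomputable def Sq (n k : ℕ) : P n →ₗ[ZMod 2] P n :=
  ((Polynomial.lcoeff (P n) k).restrictScalars (ZMod 2)).comp (totalSq n).toLinearMap

/-- `Sq⁰` is the identity. -/
theorem Sq_zero (n : ℕ) (f : P n) : Sq n 0 f = f := by
  have h : ((Polynomial.aeval (0 : P n)).restrictScalars (ZMod 2)).comp (totalSq n)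
      = AlgHom.id (ZMod 2) (P n) := by
    ext i
    simp [totalSq]
  have := DFunLike.congr_fun h f
  simpa [Sq, Polynomial.coeff_zero_eq_aeval_zero] using this

/-- `Sq¹ xᵢ = xᵢ²`. -/
theorem Sq_one_X (n : ℕ) (i : Fin n) :
    Sq n 1 (MvPolynomial.X i) = MvPolynomial.X i ^ 2 := by
  simp [Sq, totalSq, Polynomial.coeff_C, -map_pow]

/-- `Sqᵏ xᵢ = 0` for `k > 1`. -/
theorem Sq_X (n k : ℕ) (hk : 1 < k) (i : Fin n) :
    Sq n k (MvPolynomial.X i) = 0 := by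
  have h1 : k ≠ 0 := by omega
  have h2 : (1 : ℕ) ≠ k := by omega
  simp [Sq, totalSq, Polynomial.coeff_C, Polynomial.coeff_X, h1, h2, -map_pow]

/-- The Cartan formula. -/
theorem Sq_mul (n k : ℕ) (f g : P n) :
    Sq n k (f * g) = ∑ p ∈ Finset.HasAntidiagonal.antidiagonal k, Sq n p.1 f * Sq n p.2 g := by
  simp [Sq, Polynomial.coeff_mul]

/-- The hit polynomials: finite sums `∑_{k>0} Sqᵏ(gₖ)`. -/
noncomputable def hits (n : ℕ) : Submodule (ZMod 2) (P n) :=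
  Submodule.span (ZMod 2) {h | ∃ k : ℕ, 0 < k ∧ ∃ g : P n, h = Sq n k g}

/-- The cohits `Q^d(n)`: the quotient of the polynomials of degree `d` by the hit ones. -/
abbrev Cohits (n d : ℕ) : Type := homog n d ⧸ (hits n).submoduleOf (homog n d)

/-- The class in `Q^d(n)` of the monomial of degree `d` with exponent vector `e`. -/
noncomputable def monomialClass {n d : ℕ} (e : Fin n →₀ ℕ) (he : e.degree = d) : Cohits n d :=
  Submodule.Quotient.mk
    ⟨MvPolynomial.monomial e 1, MvPolynomial.isHomogeneous_monomial 1 he⟩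

/-- `(0,1)`-arrays with `n` rows; columns are indexed from `0` and the array is continued to the
right (by zeros, for the block of a monomial). -/
abbrev BinArray (n : ℕ) : Type := Fin n → ℕ → Bool

/-- The block of a monomial: row `i` is the reversed binary expansion of the `i`-th exponent. -/
def block {n : ℕ} (e : Fin n →₀ ℕ) : BinArray n := fun i j => (e i).testBit j

/-- The rows occupied by a digit `1` in column `j`. -/
def column {n : ℕ} (F : BinArray n) (j : ℕ) : Finset (Fin n) :=
  Finset.univ.filter fun i => F i j = true

/-- The `ω`-vector: the vector of column sums. -/
def omega {n : ℕ} (F : BinArray n) : ℕ → ℕ := fun j => (column F j).card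

/-- The array `F[r]` formed by the first `r` rows of `F`. -/
def firstRows {n : ℕ} (F : BinArray n) (r : ℕ) (hr : r ≤ n) : BinArray r :=
  fun i j => F (Fin.castLE hr i) j

/-- A block is semistandard if `ω(F[r])` is descending for `1 ≤ r ≤ n`. -/
def IsSemistandard {n : ℕ} (F : BinArray n) : Prop :=
  ∀ (r : ℕ) (hr : r ≤ n), 1 ≤ r → Antitone (omega (firstRows F r hr))

/-- `w` is a descending `ω`-vector of (a monomial in) `P^d(n)`. -/
def IsDescendingOmega (n d : ℕ) (w : ℕ → ℕ) : Prop :=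
  Antitone w ∧ ∃ e : Fin n →₀ ℕ, e.degree = d ∧ omega (block e) = w

/-- `d` is row-regular for `n`: `d = ∑ (2^{lam i} - 1)` over `n` strictly decreasing
nonnegative integers `lam i`. -/
def IsRowRegular (n d : ℕ) : Prop :=
  ∃ lam : Fin n → ℕ, StrictAnti lam ∧ d = ∑ i, (2 ^ lam i - 1)

/-- The column-position array of `F`: column `j` lists in increasing order the positions, counted
from `1`, of the rows with a digit `1` in column `j` of `F`, followed by zeros. -/
def cp {n : ℕ} (F : BinArray n) : ℕ → ℕ → ℕ := fun i j =>
  (((column F j).sort (· ≤ ·)).map fun r => (r : ℕ) + 1).getD i 0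

/-- The semistandard Young tableaux of shape `μ` with entries in `{1, …, n}`. -/
abbrev Tableaux (n : ℕ) (μ : YoungDiagram) : Type :=
  {T : SemistandardYoungTableau μ // ∀ i j : ℕ, (i, j) ∈ μ → 1 ≤ T i j ∧ T i j ≤ n}

end HitProblem

/-! A monomial with a column sum `ω_k` for which the higher columns have a degree that is not a sum
of `ω_k` numbers `2 ^ a - 1` is, modulo hit polynomials, a sum of monomials with a
lexicographically smaller `ω`-vector: lift a hit equation for the higher columns by Frobenius and
absorb the rest by the Cartan formula. Since sums of numbers `2 ^ a - 1` are exactly the degrees of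
the descending vectors, every monomial whose `ω`-vector lies lexicographically below all descending
vectors is hit.

Applied to a monomial `x^f`, the square `Sq^(m 2^k)` adds `2 ^ k` to `m` exponents with digits
`1, 0` in the columns `k, k + 1`, up to hit monomials and to monomials with larger columns from
`k + 2` on. If among the first `ρ` rows of the block of `x^e` column `k + 1` has more digits `1`
than column `k`, then an inclusion-exclusion sum mod 2 of such relations expresses `x^e` by
monomials that arise from it by moving digits of column `k + 1` to rows further down. Repeated
exchanges therefore end with the semistandard blocks. -/

namespace HitProblem

open Finset MvPolynomial

/-! ### Binary digits -/

theorem choose_mod_two_eq_one_iff (m t : ℕ) :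
    m.choose t % 2 = 1 ↔ ∀ j, t.testBit j ≤ m.testBit j := by
  have : Fact (Nat.Prime 2) := ⟨Nat.prime_two⟩
  have hm : m < 2 ^ (m + t) := (Nat.le_add_right m t).trans_lt Nat.lt_two_pow_self
  have ht : t < 2 ^ (m + t) := (Nat.le_add_left t m).trans_lt Nat.lt_two_pow_self
  have hdigit (j : ℕ) :
      ¬ 2 ∣ (m / 2 ^ j % 2).choose (t / 2 ^ j % 2) ↔ t.testBit j ≤ m.testBit j := by
    rw [Nat.testBit_eq_decide_div_mod_eq, Nat.testBit_eq_decide_div_mod_eq, Bool.le_iff_imp]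
    rcases Nat.mod_two_eq_zero_or_one (m / 2 ^ j) with hmj | hmj <;>
    rcases Nat.mod_two_eq_zero_or_one (t / 2 ^ j) with htj | htj <;> simp [hmj, htj]
  rw [Choose.choose_modEq_prod_range_choose_nat (p := 2) hm ht, ← Nat.two_dvd_ne_zero,
    Nat.prime_two.prime.dvd_finsetProd_iff]
  simp only [not_exists, not_and, hdigit, mem_range]
  refine ⟨fun h j => ?_, fun h j _ => h j⟩
  by_cases hj : j < m + t
  · exact h j hj
  · have : t < 2 ^ j := ht.trans_le (Nat.pow_le_pow_right two_pos (not_lt.1 hj))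
    simp [Nat.testBit_lt_two_pow this]

theorem two_pow_dvd_iff_testBit {k x : ℕ} : 2 ^ k ∣ x ↔ ∀ j < k, x.testBit j = false := by
  rw [Nat.dvd_iff_mod_eq_zero, Nat.eq_iff_testBit_eq]
  simp +contextual [Nat.testBit_mod_two_pow]

theorem testBit_add_of_dvd_of_lt {k j y : ℕ} (x : ℕ) (hy : 2 ^ k ∣ y) (hj : j < k) :
    (x + y).testBit j = x.testBit j := by
  obtain ⟨u, rfl⟩ := hy
  have hmod := Nat.testBit_mod_two_pow (x + 2 ^ k * u) k j
  rw [Nat.add_mul_mod_self_left, Nat.testBit_mod_two_pow] at hmod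
  simpa [hj] using hmod.symm

theorem testBit_add_of_dvd {k y : ℕ} (x : ℕ) (hy : 2 ^ k ∣ y) :
    (x + y).testBit k = (x.testBit k ^^ y.testBit k) := by
  obtain ⟨u, rfl⟩ := hy
  simp only [Nat.testBit_eq_decide_div_mod_eq, Nat.add_mul_div_left _ _ (Nat.two_pow_pos k),
    Nat.mul_div_cancel_left _ (Nat.two_pow_pos k)]
  rcases Nat.mod_two_eq_zero_or_one (x / 2 ^ k) with hx | hx <;>
  rcases Nat.mod_two_eq_zero_or_one u with hu | hu <;> simp [Nat.add_mod, hx, hu]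

variable {n : ℕ}

@[simp]
theorem mem_column {F : BinArray n} {i : Fin n} {j : ℕ} : i ∈ column F j ↔ F i j = true :=
  mem_filter.trans (and_iff_right (mem_univ _))

theorem block_le_block {t e : Fin n →₀ ℕ} :
    block t ≤ block e ↔ ∀ i j, (t i).testBit j = true → (e i).testBit j = true := by
  simp only [Pi.le_def, Bool.le_iff_imp, block]

theorem le_of_block_le_block {t e : Fin n →₀ ℕ} (h : block t ≤ block e) : t ≤ e :=
  fun i => Nat.le_of_testBit (block_le_block.1 h i)

/-! ### Steenrod squares of monomials -/

theorem natCast_eq_ite (N : ℕ) : (N : P n) = if N % 2 = 1 then 1 else 0 := by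
  rw [CharP.cast_eq_mod (P n) 2 N]
  rcases Nat.mod_two_eq_zero_or_one N with h | h <;> simp [h]

theorem totalSq_X_pow (i : Fin n) (m : ℕ) :
    totalSq n (X i ^ m) =
      ∑ t ∈ range (m + 1),
        Polynomial.C ((m.choose t : P n) * X i ^ (m + t)) * Polynomial.X ^ t := by
  rw [map_pow, totalSq, aeval_X, add_comm, add_pow]
  refine sum_congr rfl fun t ht => ?_
  obtain ⟨s, rfl⟩ := Nat.exists_eq_add_of_le (mem_range_succ_iff.1 ht)
  simp only [Nat.add_sub_cancel_left, mul_pow, map_mul, map_pow, map_natCast]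
  ring

theorem monomial_eq_prod_X_pow (e : Fin n →₀ ℕ) :
    monomial e (1 : ZMod 2) = ∏ i, X i ^ e i := by
  rw [monomial_eq, Finsupp.prod_fintype _ _ (by simp), map_one, one_mul]

theorem totalSq_monomial (e : Fin n →₀ ℕ) :
    totalSq n (monomial e 1) = ∑ t ∈ Iic e,
      Polynomial.C (((∏ i, (e i).choose (t i) : ℕ) : P n) * monomial (e + t) 1) *
        Polynomial.X ^ t.degree := by
  rw [monomial_eq_prod_X_pow, map_prod]
  simp_rw [totalSq_X_pow]
  rw [prod_univ_sum]
  refine sum_equiv Finsupp.equivFunOnFinite.symm (fun t => ?_) fun t _ => ?_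
  · simp [Finsupp.le_def]
  · rw [prod_mul_distrib, prod_pow_eq_pow_sum, ← map_prod, prod_mul_distrib,
      monomial_eq_prod_X_pow, Finsupp.degree_eq_sum]
    push_cast
    rfl

/-- The exponent vectors that `Sq K` adds to `e`: those of degree `K` whose binary digits `1` are
all binary digits `1` of `e`. -/
noncomputable def sqTerms (e : Fin n →₀ ℕ) (K : ℕ) : Finset (Fin n →₀ ℕ) :=
  open Classical in {t ∈ Iic e | t.degree = K ∧ block t ≤ block e}

theorem mem_sqTerms {e t : Fin n →₀ ℕ} {K : ℕ} :
    t ∈ sqTerms e K ↔ t.degree = K ∧ block t ≤ block e := by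
  simp only [sqTerms, mem_filter, mem_Iic]
  exact and_iff_right_of_imp fun h => le_of_block_le_block h.2

theorem Sq_monomial (K : ℕ) (e : Fin n →₀ ℕ) :
    Sq n K (monomial e 1) = ∑ t ∈ sqTerms e K, monomial (e + t) 1 := by
  classical
  have hcoeff : Sq n K (monomial e 1) = (totalSq n (monomial e 1)).coeff K := rfl
  rw [hcoeff, totalSq_monomial, Polynomial.finsetSum_coeff, sqTerms, sum_filter]
  refine sum_congr rfl fun t _ => ?_
  have hodd : (∏ i, (e i).choose (t i)) % 2 = 1 ↔ block t ≤ block e := by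
    rw [← Nat.two_dvd_ne_zero, Nat.prime_two.prime.dvd_finsetProd_iff]
    simp [choose_mod_two_eq_one_iff, Pi.le_def, block]
  rw [Polynomial.coeff_C_mul_X_pow, natCast_eq_ite]
  by_cases hK : t.degree = K <;> simp [hodd, hK, eq_comm (a := K)]

theorem Sq_degree_monomial (e : Fin n →₀ ℕ) :
    Sq n e.degree (monomial e 1) = monomial e 1 ^ 2 := by
  have hself : sqTerms e e.degree = {e} := by
    ext t
    rw [mem_sqTerms, mem_singleton]
    refine ⟨fun ⟨hdeg, hle⟩ => ?_, by rintro rfl; simp⟩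
    obtain ⟨s, rfl⟩ := exists_add_of_le (le_of_block_le_block hle)
    simpa [Finsupp.degree_eq_zero_iff] using hdeg
  rw [Sq_monomial, hself, sum_singleton, monomial_pow, one_pow, two_nsmul]

theorem Sq_two_pow_mul_pow (k K : ℕ) (g : P n) :
    Sq n (2 ^ k * K) (g ^ 2 ^ k) = Sq n K g ^ 2 ^ k := by
  have hcoeff : Sq n (2 ^ k * K) (g ^ 2 ^ k) = (totalSq n g ^ 2 ^ k).coeff (2 ^ k * K) := by
    rw [← map_pow]; rfl
  rw [hcoeff, ← Polynomial.map_iterateFrobenius_expand 2, Polynomial.coeff_map,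
    Polynomial.coeff_expand_mul' (Nat.two_pow_pos k), iterateFrobenius_def]
  rfl

theorem mul_Sq_mem {V : Submodule (ZMod 2) (P n)} {K : ℕ} {f g : P n} (hfg : Sq n K (f * g) ∈ V)
    (h : ∀ i j, 0 < i → i + j = K → Sq n i f * Sq n j g ∈ V) : f * Sq n K g ∈ V := by
  have hmem : ((0, K) : ℕ × ℕ) ∈ antidiagonal K := by simp
  rw [Sq_mul, ← add_sum_erase _ _ hmem, Sq_zero] at hfg
  refine (Submodule.add_mem_iff_left _ (Submodule.sum_mem _ fun p hp => ?_)).1 hfg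
  obtain ⟨hne, hp⟩ := mem_erase.1 hp
  rw [HasAntidiagonal.mem_antidiagonal] at hp
  refine h p.1 p.2 (Nat.pos_of_ne_zero fun h0 => hne (Prod.ext h0 ?_)) hp
  rw [← hp, h0, zero_add]

/-- The span of the hit polynomials `Sq K x^g` of degree `d`, where `K > 0` and `x^g` is a
monomial. -/
noncomputable def hitsOfDegree (n d : ℕ) : Submodule (ZMod 2) (P n) :=
  Submodule.span (ZMod 2)
    {h | ∃ (K : ℕ) (g : Fin n →₀ ℕ), 0 < K ∧ g.degree + K = d ∧ h = Sq n K (monomial g 1)}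

theorem hitsOfDegree_le_hits (n d : ℕ) : hitsOfDegree n d ≤ hits n := by
  refine Submodule.span_mono ?_
  rintro h ⟨K, g, hK, -, rfl⟩
  exact ⟨K, hK, _, rfl⟩

theorem Sq_monomial_mem_hitsOfDegree {K d : ℕ} {g : Fin n →₀ ℕ} (hK : 0 < K)
    (hd : g.degree + K = d) : Sq n K (monomial g 1) ∈ hitsOfDegree n d :=
  Submodule.subset_span ⟨K, g, hK, hd, rfl⟩

/-! ### Columns and degrees -/

theorem omega_le (F : BinArray n) (j : ℕ) : omega F j ≤ n := by
  simpa [omega] using card_le_univ (column F j)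

theorem exists_omega_block_eq_zero (e : Fin n →₀ ℕ) :
    ∃ L, ∀ j, L ≤ j → omega (block e) j = 0 := by
  refine ⟨e.degree, fun j hj => card_eq_zero.2 (eq_empty_of_forall_notMem fun i hi => ?_)⟩
  have hij : e i < 2 ^ j := ((Finsupp.le_degree i e).trans hj).trans_lt Nat.lt_two_pow_self
  simp [block, Nat.testBit_lt_two_pow hij] at hi

theorem exists_column_block_eq (C : ℕ → Finset (Fin n)) {L : ℕ} (hC : ∀ j, L ≤ j → C j = ∅) :
    ∃ e : Fin n →₀ ℕ, ∀ j, column (block e) j = C j := by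
  refine ⟨Finsupp.equivFunOnFinite.symm fun i =>
    Nat.ofBits fun j : Fin L => decide (i ∈ C j), fun j => ?_⟩
  ext i
  rw [mem_column, block, Finsupp.equivFunOnFinite_symm_apply_apply, Nat.testBit_ofBits]
  split_ifs with h
  · simp
  · simp [hC j (not_lt.1 h)]

theorem exists_omega_block_eq {w : ℕ → ℕ} (hw : ∀ j, w j ≤ n) {L : ℕ}
    (hL : ∀ j, L ≤ j → w j = 0) : ∃ e : Fin n →₀ ℕ, omega (block e) = w := by
  obtain ⟨e, he⟩ := exists_column_block_eq (fun j => {i : Fin n | (i : ℕ) < w j})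
    (L := L) fun j hj => by simp [hL j hj]
  refine ⟨e, funext fun j => ?_⟩
  rw [omega, he, Fin.card_filter_val_lt, min_eq_right (hw j)]

/-- The exponents formed by the first `k` columns of the block of `e`. -/
noncomputable def lowDigits (k : ℕ) (e : Fin n →₀ ℕ) : Fin n →₀ ℕ :=
  e.mapRange (· % 2 ^ k) (Nat.zero_mod _)

/-- The exponents whose block is that of `e` without its first `k` columns. -/
noncomputable def highDigits (k : ℕ) (e : Fin n →₀ ℕ) : Fin n →₀ ℕ :=
  e.mapRange (· / 2 ^ k) (Nat.zero_div _)

theorem lowDigits_add_highDigits (k : ℕ) (e : Fin n →₀ ℕ) :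
    lowDigits k e + 2 ^ k • highDigits k e = e := by
  ext i
  simp [lowDigits, highDigits, Nat.mod_add_div]

theorem highDigits_highDigits (k l : ℕ) (e : Fin n →₀ ℕ) :
    highDigits l (highDigits k e) = highDigits (k + l) e := by
  ext i
  simp [highDigits, Nat.div_div_eq_div_mul, pow_add]

theorem omega_block_highDigits (k : ℕ) (e : Fin n →₀ ℕ) (j : ℕ) :
    omega (block (highDigits k e)) j = omega (block e) (k + j) := by
  unfold omega
  congr 1
  ext i
  simp [block, highDigits, Nat.testBit_div_two_pow, add_comm]

theorem degree_lowDigits (k : ℕ) (e : Fin n →₀ ℕ) :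
    (lowDigits k e).degree = ∑ j ∈ range k, omega (block e) j * 2 ^ j := by
  simp only [Finsupp.degree_eq_sum, lowDigits, Finsupp.mapRange_apply]
  induction k with
  | zero => simp [Nat.mod_one]
  | succ k ih =>
    rw [sum_range_succ, ← ih, omega, card_eq_sum_ones, sum_mul, column, sum_filter,
      ← sum_add_distrib]
    refine sum_congr rfl fun i _ => ?_
    rw [pow_succ, Nat.mod_mul, block, Nat.testBit_eq_decide_div_mod_eq]
    rcases Nat.mod_two_eq_zero_or_one (e i / 2 ^ k) with h | h <;> simp [h]

theorem degree_eq_sum_add_highDigits (k : ℕ) (e : Fin n →₀ ℕ) :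
    e.degree = ∑ j ∈ range k, omega (block e) j * 2 ^ j + 2 ^ k * (highDigits k e).degree := by
  nth_rw 1 [← lowDigits_add_highDigits k e]
  rw [map_add, map_nsmul, degree_lowDigits, smul_eq_mul]

theorem degree_highDigits (k : ℕ) (e : Fin n →₀ ℕ) :
    (highDigits k e).degree = omega (block e) k + 2 * (highDigits (k + 1) e).degree := by
  rw [degree_eq_sum_add_highDigits 1 (highDigits k e), highDigits_highDigits]
  simp [omega_block_highDigits]

theorem degree_eq_sum_omega {e : Fin n →₀ ℕ} {L : ℕ}
    (hL : ∀ j, L ≤ j → omega (block e) j = 0) :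
    e.degree = ∑ j ∈ range L, omega (block e) j * 2 ^ j := by
  have hzero : highDigits L e = 0 := by
    ext i
    refine Nat.zero_of_testBit_eq_false fun j => ?_
    have hcol := card_eq_zero.1 (hL (L + j) (Nat.le_add_right L j))
    have hi : i ∉ column (block e) (L + j) := by simp [hcol]
    simpa [highDigits, block, Nat.testBit_div_two_pow, add_comm] using hi
  rw [degree_eq_sum_add_highDigits L, hzero, map_zero, mul_zero, add_zero]

/-! ### Products of two-powers of variables -/

/-- Every exponent in the support of `f` is a power of two. -/
def IsTwoPowers (f : Fin n →₀ ℕ) : Prop := ∀ i ∈ f.support, ∃ a, f i = 2 ^ a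

theorem eq_zero_or_eq_two_pow {t a : ℕ} (h : ∀ j, t.testBit j = true → (2 ^ a).testBit j = true) :
    t = 0 ∨ t = 2 ^ a := by
  have htest (j : ℕ) : t.testBit j = true → a = j := fun hj => by
    simpa [Nat.testBit_two_pow] using h j hj
  by_cases ha : t.testBit a
  · refine .inr (Nat.eq_of_testBit_eq fun j => Bool.eq_iff_iff.2 ⟨h j, fun hj => ?_⟩)
    rwa [← show a = j by simpa [Nat.testBit_two_pow] using hj]
  · refine .inl (Nat.zero_of_testBit_eq_false fun j => Bool.eq_false_iff.2 fun hj => ha ?_)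
    rwa [htest j hj]

theorem IsTwoPowers.add {f t : Fin n →₀ ℕ} (hf : IsTwoPowers f) (ht : block t ≤ block f) :
    IsTwoPowers (f + t) ∧ (f + t).support = f.support := by
  have hsupp : (f + t).support = f.support := by
    ext i
    have := le_of_block_le_block ht i
    simp only [Finsupp.mem_support_iff, Finsupp.add_apply]
    lia
  refine ⟨fun i hi => ?_, hsupp⟩
  obtain ⟨a, ha⟩ := hf i (hsupp ▸ hi)
  rcases eq_zero_or_eq_two_pow (ha ▸ block_le_block.1 ht i) with hti | hti
  · exact ⟨a, by simp [ha, hti]⟩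
  · exact ⟨a + 1, by simp [ha, hti, pow_succ, mul_two]⟩

theorem monomial_mul_Sq_mem_hitsOfDegree {f h : Fin n →₀ ℕ} {K : ℕ} (hf : IsTwoPowers f)
    (hno : ∀ f', IsTwoPowers f' → f'.support = f.support → f'.degree ≠ f.degree + K) :
    monomial f 1 * Sq n K (monomial h 1) ∈ hitsOfDegree n (f.degree + h.degree + K) := by
  induction K using Nat.strong_induction_on generalizing f with
  | _ K ih =>
    have hK : 0 < K := Nat.pos_of_ne_zero fun h0 => hno f hf rfl (by rw [h0, add_zero])
    refine mul_Sq_mem ?_ fun i j hi hij => ?_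
    · rw [monomial_mul, one_mul]
      exact Sq_monomial_mem_hitsOfDegree hK (by rw [map_add])
    · rw [Sq_monomial, sum_mul]
      refine Submodule.sum_mem _ fun t ht => ?_
      obtain ⟨rfl, hle⟩ := mem_sqTerms.1 ht
      obtain ⟨hft, hsupp⟩ := hf.add hle
      have hdeg : (f + t).degree + j = f.degree + K := by rw [map_add]; lia
      have := ih j (by lia) hft fun f' hf' hs hd => hno f' hf' (hs.trans hsupp) (hd.trans hdeg)
      rwa [show (f + t).degree + h.degree + j = f.degree + h.degree + K by lia] at this

/-- The degree of the spike `∏ x_i ^ (2 ^ aᵢ - 1)`, where the `aᵢ` are the members of `s`. -/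
def spikeDegree (s : Multiset ℕ) : ℕ := (s.map (2 ^ · - 1)).sum

/-- `T` is a sum of `m` numbers of the form `2 ^ a - 1`. -/
def IsSpikeSum (m T : ℕ) : Prop := ∃ s : Multiset ℕ, s.card = m ∧ spikeDegree s = T

theorem IsTwoPowers.isSpikeSum {f : Fin n →₀ ℕ} (hf : IsTwoPowers f) {T : ℕ}
    (hT : f.degree = #f.support + T) : IsSpikeSum #f.support T := by
  choose! a ha using hf
  refine ⟨f.support.val.map a, Multiset.card_map _ _, ?_⟩
  have hsum : ∑ i ∈ f.support, (2 ^ a i - 1 + 1) = ∑ i ∈ f.support, f i :=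
    sum_congr rfl fun i hi => by rw [ha i hi, Nat.sub_add_cancel Nat.one_le_two_pow]
  rw [sum_add_distrib, sum_const, smul_eq_mul, mul_one, ← Finsupp.degree_apply, hT,
    add_comm] at hsum
  rw [spikeDegree, Multiset.map_map]
  exact Nat.add_left_cancel hsum

theorem monomial_mem_hitsOfDegree_of_not_isSpikeSum {e : Fin n →₀ ℕ}
    (he : ¬ IsSpikeSum (omega (block e) 0) (highDigits 1 e).degree) :
    monomial e 1 ∈ hitsOfDegree n e.degree := by
  have hdeg : (lowDigits 1 e).degree = omega (block e) 0 := by simp [degree_lowDigits]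
  have hlt (i : Fin n) : lowDigits 1 e i < 2 := Nat.mod_lt _ two_pos
  have hsupp : #(lowDigits 1 e).support = omega (block e) 0 := by
    rw [← hdeg, Finsupp.degree_apply, card_eq_sum_ones]
    exact sum_congr rfl fun i hi => by
      have := Finsupp.mem_support_iff.1 hi
      have := hlt i
      lia
  have hlow : IsTwoPowers (lowDigits 1 e) := fun i hi => ⟨0, by
    have := Finsupp.mem_support_iff.1 hi
    have := hlt i
    rw [pow_zero]
    lia⟩
  have hmem := monomial_mul_Sq_mem_hitsOfDegree (h := highDigits 1 e)
    (K := (highDigits 1 e).degree) hlow fun f' hf' hs hd => he <| by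
      rw [← hsupp, ← hs]
      exact hf'.isSpikeSum (by rw [hd, hdeg, hs, hsupp])
  rw [Sq_degree_monomial, monomial_pow, monomial_mul, one_pow, one_mul] at hmem
  have hsplit := lowDigits_add_highDigits 1 e
  rw [pow_one] at hsplit
  rw [hsplit] at hmem
  convert hmem using 2
  nth_rw 1 [← hsplit]
  rw [map_add, map_nsmul, two_nsmul, add_assoc]

/-! ### Squares acting to the left of a column -/

/-- `w` is smaller than `v` at the first column where they differ, and this is before `k`. -/
def LowerBefore (k : ℕ) (w v : ℕ → ℕ) : Prop := ∃ c < k, (∀ j < c, w j = v j) ∧ w c < v c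

theorem LowerBefore.toLex_lt {k : ℕ} {w v : ℕ → ℕ} (h : LowerBefore k w v) : toLex w < toLex v :=
  let ⟨c, _, hc⟩ := h
  ⟨c, hc⟩

theorem omega_block_add_of_dvd {k j : ℕ} {y : Fin n →₀ ℕ} (e : Fin n →₀ ℕ)
    (hy : ∀ i, 2 ^ k ∣ y i) (hj : j < k) : omega (block (e + y)) j = omega (block e) j := by
  refine congrArg card (filter_congr fun i _ => ?_)
  rw [block, Finsupp.add_apply, testBit_add_of_dvd_of_lt _ (hy i) hj, block]

theorem lowerBefore_add {k : ℕ} {e t y : Fin n →₀ ℕ} (hle : block t ≤ block e)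
    (hne : ∃ i, ¬ 2 ^ k ∣ t i) (hy : ∀ i, 2 ^ k ∣ y i) :
    LowerBefore k (omega (block (e + t + y))) (omega (block e)) := by
  classical
  have hex : ∃ c, c < k ∧ ∃ i, (t i).testBit c = true := by
    obtain ⟨i, hi⟩ := hne
    simp only [two_pow_dvd_iff_testBit, not_forall, Bool.not_eq_false] at hi
    obtain ⟨c, hc, htc⟩ := hi
    exact ⟨c, hc, i, htc⟩
  obtain ⟨c, ⟨hck, i₀, hi₀⟩, hmin⟩ :
      ∃ c, (c < k ∧ ∃ i, (t i).testBit c = true) ∧ ∀ j < c, ∀ i, (t i).testBit j = false := by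
    refine ⟨Nat.find hex, Nat.find_spec hex, fun j hj i => ?_⟩
    have := Nat.find_min hex hj
    simp only [not_and, not_exists, Bool.not_eq_true] at this
    exact this (hj.trans (Nat.find_spec hex).1) i
  have hdvd (i : Fin n) : 2 ^ c ∣ (t + y) i :=
    dvd_add (two_pow_dvd_iff_testBit.2 fun j hj => hmin j hj i)
      ((pow_dvd_pow 2 hck.le).trans (hy i))
  have hbit (i : Fin n) : ((e + (t + y)) i).testBit c = ((e i).testBit c ^^ (t i).testBit c) := by
    rw [Finsupp.add_apply, testBit_add_of_dvd _ (hdvd i), Finsupp.add_apply,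
      testBit_add_of_dvd_of_lt _ (hy i) hck]
  rw [block_le_block] at hle
  rw [add_assoc]
  refine ⟨c, hck, fun j hj => omega_block_add_of_dvd e hdvd hj, ?_⟩
  refine card_lt_card ((ssubset_iff_of_subset fun i hi => ?_).2 ⟨i₀, ?_, ?_⟩)
  · rw [mem_column, block, hbit] at hi
    rw [mem_column, block]
    by_cases hti : (t i).testBit c = true
    · exact hle i c hti
    · simpa [hti] using hi
  · exact mem_column.2 (hle i₀ c hi₀)
  · simp [block, hbit, hi₀, hle i₀ c hi₀, -Finsupp.coe_add]

/-- The span of the monomials of degree `d` whose exponents satisfy `p`. -/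
noncomputable def monoSpan (d : ℕ) (p : (Fin n →₀ ℕ) → Prop) : Submodule (ZMod 2) (P n) :=
  Submodule.span (ZMod 2) {q | ∃ e : Fin n →₀ ℕ, e.degree = d ∧ p e ∧ q = monomial e 1}

theorem monomial_mem_monoSpan {d : ℕ} {p : (Fin n →₀ ℕ) → Prop} {e : Fin n →₀ ℕ}
    (hd : e.degree = d) (hp : p e) : monomial e 1 ∈ monoSpan d p :=
  Submodule.subset_span ⟨e, hd, hp, rfl⟩

theorem monoSpan_le {d : ℕ} {p : (Fin n →₀ ℕ) → Prop} {V : Submodule (ZMod 2) (P n)}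
    (h : ∀ e, e.degree = d → p e → monomial e 1 ∈ V) : monoSpan d p ≤ V := by
  refine Submodule.span_le.2 ?_
  rintro q ⟨e, hd, hp, rfl⟩
  exact h e hd hp

theorem monomial_mul_Sq_pow_mem {k K : ℕ} {l g : Fin n →₀ ℕ} (hl : ∀ i, l i < 2 ^ k)
    (hK : 0 < K) :
    monomial l 1 * Sq n K (monomial g 1) ^ 2 ^ k ∈
      hitsOfDegree n (l.degree + 2 ^ k * (g.degree + K)) ⊔
        monoSpan (l.degree + 2 ^ k * (g.degree + K)) fun e =>
          LowerBefore k (omega (block e)) (omega (block l)) := by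
  have hpos : 0 < 2 ^ k := Nat.two_pow_pos k
  have hSq (m : ℕ) : Sq n m (monomial g 1) ^ 2 ^ k =
      Sq n (2 ^ k * m) (monomial (2 ^ k • g) 1) := by
    rw [← Sq_two_pow_mul_pow, monomial_pow, one_pow]
  rw [hSq]
  refine mul_Sq_mem (Submodule.mem_sup_left ?_) fun i j hi hij => Submodule.mem_sup_right ?_
  · rw [monomial_mul, one_mul]
    exact Sq_monomial_mem_hitsOfDegree (Nat.mul_pos hpos hK)
      (by rw [map_add, map_nsmul, smul_eq_mul]; ring)
  rw [Sq_monomial, Sq_monomial, sum_mul_sum]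
  refine Submodule.sum_mem _ fun t ht => Submodule.sum_mem _ fun u hu => ?_
  obtain ⟨rfl, htl⟩ := mem_sqTerms.1 ht
  obtain ⟨rfl, hug⟩ := mem_sqTerms.1 hu
  rw [monomial_mul, one_mul]
  refine monomial_mem_monoSpan ?_ (lowerBefore_add htl ?_ fun i => ?_)
  · simp only [map_add, map_nsmul, smul_eq_mul, mul_add, ← hij]
    ring
  · by_contra! hdvd
    have ht0 : t = 0 := Finsupp.ext fun i =>
      Nat.eq_zero_of_dvd_of_lt (hdvd i) ((le_of_block_le_block htl i).trans_lt (hl i))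
    simp [ht0] at hi
  · refine dvd_add (Dvd.intro _ rfl) (two_pow_dvd_iff_testBit.2 fun j hj => ?_)
    rw [← Bool.not_eq_true]
    intro huj
    simpa [hj.not_ge, Nat.testBit_two_pow_mul] using block_le_block.1 hug i j huj

theorem monomial_mul_pow_mem {k d : ℕ} {l : Fin n →₀ ℕ} (hl : ∀ i, l i < 2 ^ k) {b : P n}
    (hb : b ∈ hitsOfDegree n d) :
    monomial l 1 * b ^ 2 ^ k ∈ hitsOfDegree n (l.degree + 2 ^ k * d) ⊔
      monoSpan (l.degree + 2 ^ k * d) fun e =>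
        LowerBefore k (omega (block e)) (omega (block l)) := by
  induction hb using Submodule.span_induction with
  | zero => simp
  | add x y _ _ hx hy =>
    rw [add_pow_char_pow x y 2 k, mul_add]
    exact Submodule.add_mem _ hx hy
  | smul r x _ hx =>
    rw [smul_pow, mul_smul_comm]
    exact Submodule.smul_mem _ _ hx
  | mem x hx =>
    obtain ⟨K, g, hK, rfl, rfl⟩ := hx
    exact monomial_mul_Sq_pow_mem hl hK

theorem monomial_mem_hitsOfDegree_sup_lowerBefore {e : Fin n →₀ ℕ} {k : ℕ}
    (he : ¬ IsSpikeSum (omega (block e) k) (highDigits (k + 1) e).degree) :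
    monomial e 1 ∈ hitsOfDegree n e.degree ⊔
      monoSpan e.degree fun e' => LowerBefore k (omega (block e')) (omega (block e)) := by
  have hhigh : monomial (highDigits k e) 1 ∈ hitsOfDegree n (highDigits k e).degree :=
    monomial_mem_hitsOfDegree_of_not_isSpikeSum <| by
      rwa [omega_block_highDigits, highDigits_highDigits, add_zero]
  have hmem := monomial_mul_pow_mem (l := lowDigits k e)
    (fun i => Nat.mod_lt _ (Nat.two_pow_pos k)) hhigh
  have hdeg : (lowDigits k e).degree + 2 ^ k * (highDigits k e).degree = e.degree := by
    rw [← smul_eq_mul, ← map_nsmul, ← map_add, lowDigits_add_highDigits]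
  rw [monomial_pow, monomial_mul, one_pow, one_mul, lowDigits_add_highDigits, hdeg] at hmem
  refine sup_le_sup_left (monoSpan_le fun e' hd h => monomial_mem_monoSpan hd ?_) _ hmem
  obtain ⟨c, hc, heq, hlt⟩ := h
  have homega (j : ℕ) (hj : j < k) : omega (block (lowDigits k e)) j = omega (block e) j := by
    nth_rw 2 [← lowDigits_add_highDigits k e]
    exact (omega_block_add_of_dvd _ (fun i => Dvd.intro _ rfl) hj).symm
  exact ⟨c, hc, fun j hj => (heq j hj).trans (homega j (hj.trans hc)), hlt.trans_eq (homega c hc)⟩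

/-! ### Spikes and descending vectors -/

theorem exists_youngDiagram_colLen_eq {w : ℕ → ℕ} (hw : Antitone w) {L : ℕ}
    (hL : ∀ j, L ≤ j → w j = 0) : ∃ μ : YoungDiagram, μ.colLen = w := by
  let μ : YoungDiagram :=
    { cells := {p ∈ range (w 0) ×ˢ range L | p.1 < w p.2}
      isLowerSet := by
        rintro ⟨i, j⟩ ⟨i', j'⟩ ⟨hi, hj⟩ hmem
        simp only [coe_filter, mem_product, mem_range, Set.mem_ofPred_eq] at hmem hi hj ⊢
        have := hw hj
        lia }
  have hμ (i j : ℕ) : (i, j) ∈ μ ↔ i < w j := by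
    refine ⟨fun h => (mem_filter.1 h).2, fun h => mem_filter.2 ⟨?_, h⟩⟩
    have := hw (Nat.zero_le j)
    have hj : j < L := by
      by_contra! hj
      simp [hL j hj] at h
    exact mem_product.2 ⟨mem_range.2 (h.trans_le this), mem_range.2 hj⟩
  exact ⟨μ, funext fun j => eq_of_forall_lt_iff fun i => by
    rw [← YoungDiagram.mem_iff_lt_colLen, hμ]⟩

/-- The `ω`-vector of the spike `∏ x_i ^ (2 ^ aᵢ - 1)`, where the `aᵢ` are the members of `s`. -/
def spikeOmega (s : Multiset ℕ) : ℕ → ℕ := fun j => s.countP (j < ·)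

theorem antitone_spikeOmega (s : Multiset ℕ) : Antitone (spikeOmega s) := fun _ _ hij => by
  simp only [spikeOmega, Multiset.countP_eq_card_filter]
  exact Multiset.card_le_card (Multiset.monotone_filter_right s fun _ h => hij.trans_lt h)

theorem spikeOmega_le_card (s : Multiset ℕ) (j : ℕ) : spikeOmega s j ≤ s.card :=
  Multiset.countP_le_card _ _

theorem spikeOmega_eq_zero {s : Multiset ℕ} {j : ℕ} (hj : s.sup ≤ j) : spikeOmega s j = 0 :=
  Multiset.countP_eq_zero.2 fun _ ha => ((Multiset.le_sup ha).trans hj).not_gt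

theorem sum_spikeOmega_mul_two_pow {s : Multiset ℕ} {L : ℕ} (hL : ∀ a ∈ s, a ≤ L) :
    ∑ j ∈ range L, spikeOmega s j * 2 ^ j = spikeDegree s := by
  induction s using Multiset.induction_on with
  | empty => simp [spikeOmega, spikeDegree]
  | cons a s ih =>
    have hrange : {j ∈ range L | j < a} = range a := by
      ext j
      have := hL a (Multiset.mem_cons_self a s)
      simp only [mem_filter, mem_range]
      lia
    have hgeom : ∑ j ∈ range a, 2 ^ j = 2 ^ a - 1 := by simp [Nat.geomSum_eq le_rfl]
    rw [spikeDegree, Multiset.map_cons, Multiset.sum_cons, ← spikeDegree,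
      ← ih fun b hb => hL b (Multiset.mem_cons_of_mem hb), ← hgeom, ← hrange, sum_filter,
      ← sum_add_distrib]
    refine sum_congr rfl fun j _ => ?_
    rw [spikeOmega, Multiset.countP_cons, spikeOmega, add_mul, ite_mul, one_mul, zero_mul, add_comm]

theorem degree_eq_spikeDegree {e : Fin n →₀ ℕ} {s : Multiset ℕ}
    (h : omega (block e) = spikeOmega s) : e.degree = spikeDegree s := by
  rw [degree_eq_sum_omega (L := s.sup) fun j hj => by rw [h, spikeOmega_eq_zero hj], h,
    sum_spikeOmega_mul_two_pow fun a ha => Multiset.le_sup ha]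

theorem exists_spikeOmega_eq {w : ℕ → ℕ} (hw : Antitone w) {m L : ℕ} (hm : w 0 ≤ m)
    (hL : ∀ j, L ≤ j → w j = 0) : ∃ s : Multiset ℕ, s.card = m ∧ spikeOmega s = w := by
  obtain ⟨μ, rfl⟩ := exists_youngDiagram_colLen_eq hw hL
  refine ⟨(range m).val.map μ.rowLen, by simp, funext fun j => ?_⟩
  have hrange : {i ∈ range m | j < μ.rowLen i} = range (μ.colLen j) := by
    ext i
    have := hw (Nat.zero_le j)
    rw [mem_filter, mem_range, mem_range, ← YoungDiagram.mem_iff_lt_rowLen,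
      YoungDiagram.mem_iff_lt_colLen]
    lia
  rw [spikeOmega, Multiset.countP_map, ← filter_val, hrange, card_val, card_range]

theorem exists_spikeOmega_eq_omega {e : Fin n →₀ ℕ} (hw : Antitone (omega (block e))) {m : ℕ}
    (hm : omega (block e) 0 ≤ m) :
    ∃ s : Multiset ℕ, s.card = m ∧ spikeDegree s = e.degree ∧ spikeOmega s = omega (block e) := by
  obtain ⟨L, hL⟩ := exists_omega_block_eq_zero e
  obtain ⟨s, hs, hsw⟩ := exists_spikeOmega_eq hw hm hL
  exact ⟨s, hs, (degree_eq_spikeDegree hsw.symm).symm, hsw⟩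

theorem isDescendingOmega_iff {d : ℕ} {w : ℕ → ℕ} :
    IsDescendingOmega n d w ↔
      ∃ s : Multiset ℕ, s.card = n ∧ spikeDegree s = d ∧ spikeOmega s = w := by
  constructor
  · rintro ⟨hanti, e, rfl, rfl⟩
    exact exists_spikeOmega_eq_omega hanti (omega_le _ 0)
  · rintro ⟨s, rfl, rfl, rfl⟩
    obtain ⟨e, he⟩ := exists_omega_block_eq (spikeOmega_le_card s) fun _ => spikeOmega_eq_zero
    exact ⟨antitone_spikeOmega s, e, degree_eq_spikeDegree he, he⟩

theorem isSpikeSum_of_antitone {e : Fin n →₀ ℕ} (hw : Antitone (omega (block e))) (k : ℕ) :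
    IsSpikeSum (omega (block e) k) (highDigits (k + 1) e).degree := by
  have hhigh := funext (omega_block_highDigits (k + 1) e)
  obtain ⟨s, hs, hdeg, -⟩ := exists_spikeOmega_eq_omega (e := highDigits (k + 1) e)
    (m := omega (block e) k) (hhigh ▸ fun i j hij => hw (by lia)) (hhigh ▸ hw (by lia))
  exact ⟨s, hs, hdeg⟩

theorem IsSpikeSum.add_two {m T : ℕ} (h : IsSpikeSum m (T + 1)) : IsSpikeSum (m + 2) T := by
  obtain ⟨s, rfl, hs⟩ := h
  obtain ⟨a, ha, ha0⟩ : ∃ a ∈ s, a ≠ 0 := by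
    by_contra! hzero
    have hdeg : spikeDegree s = 0 := Multiset.sum_eq_zero fun x hx => by
      obtain ⟨a, ha, rfl⟩ := Multiset.mem_map.1 hx
      simp [hzero a ha]
    lia
  obtain ⟨t, rfl⟩ := Multiset.exists_cons_of_mem ha
  obtain ⟨b, rfl⟩ := Nat.exists_eq_succ_of_ne_zero ha0
  refine ⟨b ::ₘ b ::ₘ 0 ::ₘ t, by simp, ?_⟩
  have := Nat.one_le_two_pow (n := b)
  simp only [spikeDegree, Multiset.map_cons, Multiset.sum_cons, pow_succ] at hs ⊢
  lia

theorem IsSpikeSum.add_two_mul {m T : ℕ} (δ : ℕ) (h : IsSpikeSum m (T + δ)) :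
    IsSpikeSum (m + 2 * δ) T := by
  induction δ generalizing m with
  | zero => exact h
  | succ δ ih =>
    rw [mul_add, mul_one, add_comm (2 * δ), ← add_assoc]
    exact ih h.add_two

theorem exists_isDescendingOmega_of_isSpikeSum {e : Fin n →₀ ℕ} {k : ℕ}
    (hanti : ∀ j < k, omega (block e) (j + 1) ≤ omega (block e) j)
    (hk : IsSpikeSum (omega (block e) k) (highDigits (k + 1) e).degree) :
    ∃ w, IsDescendingOmega n e.degree w ∧ ∀ j ≤ k, w j = omega (block e) j := by
  obtain ⟨s, hcard, hdeg⟩ := hk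
  let w (j : ℕ) : ℕ := if j ≤ k then omega (block e) j else spikeOmega s (j - (k + 1))
  have hwle (j : ℕ) (hj : j ≤ k) : w j = omega (block e) j := if_pos hj
  have hwgt (j : ℕ) : w (k + 1 + j) = spikeOmega s j := by
    simp [w, show ¬ k + 1 + j ≤ k by lia]
  have hwanti : Antitone w := by
    refine antitone_nat_of_succ_le fun j => ?_
    rcases lt_trichotomy j k with hjk | rfl | hjk
    · rw [hwle j hjk.le, hwle (j + 1) hjk]
      exact hanti j hjk
    · rw [hwle j le_rfl, ← hcard]
      exact (hwgt 0).trans_le (spikeOmega_le_card s 0)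
    · obtain ⟨l, rfl⟩ := Nat.exists_eq_add_of_le (Nat.succ_le_of_lt hjk)
      rw [Nat.succ_eq_add_one, add_assoc, hwgt, hwgt]
      exact antitone_spikeOmega s (Nat.le_succ l)
  have hwn (j : ℕ) : w j ≤ n :=
    (hwanti (Nat.zero_le j)).trans ((hwle 0 (Nat.zero_le k)).trans_le (omega_le _ _))
  obtain ⟨e', he'⟩ := exists_omega_block_eq hwn (L := k + 1 + s.sup) fun j hj => by
    obtain ⟨l, rfl⟩ := Nat.exists_eq_add_of_le (le_of_add_le_left hj)
    rw [hwgt, spikeOmega_eq_zero (by lia)]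
  refine ⟨w, ⟨hwanti, e', ?_, he'⟩, hwle⟩
  have hhigh : (highDigits (k + 1) e').degree = spikeDegree s :=
    degree_eq_spikeDegree <| funext fun j => by rw [omega_block_highDigits, he', hwgt]
  rw [degree_eq_sum_add_highDigits (k + 1) e', degree_eq_sum_add_highDigits (k + 1) e, hhigh, hdeg,
    he']
  congr 1
  exact sum_congr rfl fun j hj => by rw [hwle j (Nat.lt_succ_iff.1 (mem_range.1 hj))]

/-! ### Row-regular degrees -/

theorem eq_val_of_sum_two_pow_eq {S : Finset ℕ} {s : Multiset ℕ}
    (hsum : (s.map (2 ^ ·)).sum = ∑ a ∈ S, 2 ^ a) (hcard : s.card ≤ #S) : s = S.val := by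
  induction hc : s.card using Nat.strong_induction_on generalizing s with
  | _ c ih =>
    by_cases hnd : s.Nodup
    · exact congrArg val (geomSum_injective le_rfl hsum : (⟨s, hnd⟩ : Finset ℕ) = S)
    -- Two equal powers of two in the sum could be merged into one, which leaves too few terms.
    rw [Multiset.nodup_iff_count_le_one] at hnd
    push Not at hnd
    obtain ⟨a, ha⟩ := hnd
    obtain ⟨t, rfl⟩ := Multiset.le_iff_exists_add.1 (Multiset.le_count_iff_replicate_le.1 ha)
    have ht : (Multiset.replicate 2 a + t).card = ((a + 1) ::ₘ t).card + 1 := by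
      simp [add_comm]
    have hmerge := ih _ (by lia) (s := (a + 1) ::ₘ t)
      (by rw [← hsum]; simp [Multiset.replicate_succ]; ring) (by lia) rfl
    rw [ht, hmerge] at hcard
    exact absurd hcard (Nat.not_succ_le_self _)

theorem spikeDegree_add_card (s : Multiset ℕ) :
    spikeDegree s + s.card = (s.map (2 ^ ·)).sum := by
  unfold spikeDegree
  induction s using Multiset.induction_on with
  | empty => rfl
  | cons a s ih =>
    have := Nat.one_le_two_pow (n := a)
    simp only [Multiset.map_cons, Multiset.sum_cons, Multiset.card_cons]
    lia

theorem existsUnique_isDescendingOmega_of_isRowRegular {d : ℕ} (h : IsRowRegular n d) :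
    ∃! w : ℕ → ℕ, IsDescendingOmega n d w := by
  obtain ⟨lam, hlam, rfl⟩ := h
  let S : Finset ℕ := univ.map ⟨lam, hlam.injective⟩
  have hcard : #S = n := by simp [S]
  have hdeg : spikeDegree S.val = ∑ i, (2 ^ lam i - 1) :=
    sum_map univ ⟨lam, hlam.injective⟩ (2 ^ · - 1)
  refine ⟨spikeOmega S.val, isDescendingOmega_iff.2 ⟨S.val, hcard, hdeg, rfl⟩, fun w hw => ?_⟩
  obtain ⟨s, hs, hsdeg, rfl⟩ := isDescendingOmega_iff.1 hw
  rw [eq_val_of_sum_two_pow_eq (S := S) _ (hs.trans hcard.symm).le]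
  rw [← spikeDegree_add_card, hsdeg, ← hdeg, hs, ← hcard, card_def, spikeDegree_add_card]
  rfl

/-! ### Monomials compared with the descending vectors -/

theorem degree_induction {α : Type*} [Preorder α] (φ : (Fin n →₀ ℕ) → α) {d : ℕ}
    {q : (Fin n →₀ ℕ) → Prop}
    (h : ∀ e, e.degree = d → (∀ e', e'.degree = d → φ e' < φ e → q e') → q e)
    {e : Fin n →₀ ℕ} (he : e.degree = d) : q e := by
  have : Finite {e : Fin n →₀ ℕ // e.degree = d} := (Finsupp.finite_of_degree_eq d).to_subtype
  let r (a b : {e : Fin n →₀ ℕ // e.degree = d}) : Prop := φ a < φ b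
  have : IsTrans _ r := ⟨fun _ _ _ => lt_trans⟩
  have : Std.Irrefl r := ⟨fun _ => lt_irrefl _⟩
  suffices H : ∀ a : {e : Fin n →₀ ℕ // e.degree = d}, q a from H ⟨e, he⟩
  intro a
  induction a using (Finite.wellFounded_of_trans_of_irrefl r).induction with
  | _ a ih => exact h a a.2 fun e' he' hlt => ih ⟨e', he'⟩ hlt

theorem monomial_mem_hitsOfDegree_of_lex_lt {e : Fin n →₀ ℕ} {d : ℕ} (hd : e.degree = d)
    (hlow : ∀ w, IsDescendingOmega n d w → toLex (omega (block e)) < toLex w) :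
    monomial e 1 ∈ hitsOfDegree n d := by
  refine degree_induction (fun e => toLex (omega (block e)))
    (q := fun e => (∀ w, IsDescendingOmega n d w → toLex (omega (block e)) < toLex w) →
      monomial e 1 ∈ hitsOfDegree n d) ?_ hd hlow
  clear! e
  rintro e rfl ih hlow
  have hanti : ∃ k, omega (block e) k < omega (block e) (k + 1) := by
    by_contra! hanti
    exact lt_irrefl _ (hlow _ ⟨antitone_nat_of_succ_le hanti, e, rfl, rfl⟩)
  obtain ⟨k, hk, hfirst⟩ : ∃ k, omega (block e) k < omega (block e) (k + 1) ∧
      ∀ j < k, omega (block e) (j + 1) ≤ omega (block e) j := by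
    classical
    exact ⟨Nat.find hanti, Nat.find_spec hanti, fun j hj => not_lt.1 (Nat.find_min hanti hj)⟩
  have hnot : ¬ IsSpikeSum (omega (block e) k) (highDigits (k + 1) e).degree := fun hspike => by
    obtain ⟨w, hw, hwe⟩ := exists_isDescendingOmega_of_isSpikeSum hfirst hspike
    refine (hlow w hw).not_gt ⟨k + 1, fun j hj => hwe j (Nat.lt_succ_iff.1 hj), ?_⟩
    exact ((hw.1 k.le_succ).trans_eq (hwe k le_rfl)).trans_lt hk
  refine sup_le le_rfl (monoSpan_le fun e' hd' hlt => ?_)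
    (monomial_mem_hitsOfDegree_sup_lowerBefore hnot)
  exact ih e' hd' hlt.toLex_lt fun w hw => hlt.toLex_lt.trans (hlow w hw)

theorem exists_isDescendingOmega_of_lt {e : Fin n →₀ ℕ} {w₀ : ℕ → ℕ} {k : ℕ}
    (hw₀ : IsDescendingOmega n e.degree w₀) (heq : ∀ j < k, omega (block e) j = w₀ j)
    (hlt : w₀ k < omega (block e) k)
    (hanti : ∀ j < k, omega (block e) (j + 1) ≤ omega (block e) j) :
    ∃ w, IsDescendingOmega n e.degree w ∧ ∀ j ≤ k, w j = omega (block e) j := by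
  obtain ⟨hw₀anti, e₀, hdeg, rfl⟩ := hw₀
  have hhigh : (highDigits k e₀).degree = (highDigits k e).degree := by
    rw [degree_eq_sum_add_highDigits k e₀, degree_eq_sum_add_highDigits k e,
      sum_congr rfl fun j hj => by rw [← heq j (mem_range.1 hj)]] at hdeg
    exact Nat.eq_of_mul_eq_mul_left (Nat.two_pow_pos k) (Nat.add_left_cancel hdeg)
  rw [degree_highDigits k e₀, degree_highDigits k e] at hhigh
  obtain ⟨δ, hδ⟩ : ∃ δ, (highDigits (k + 1) e₀).degree = (highDigits (k + 1) e).degree + δ :=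
    Nat.exists_eq_add_of_le (by lia)
  have hspike := (hδ ▸ isSpikeSum_of_antitone hw₀anti k).add_two_mul δ
  rw [show omega (block e₀) k + 2 * δ = omega (block e) k by lia] at hspike
  exact exists_isDescendingOmega_of_isSpikeSum hanti hspike

/-! ### Exchanging the digits of two adjacent columns -/

/-- The number of digits `1` in column `j` of `F` among the first `r` rows. -/
def topCount (F : BinArray n) (r j : ℕ) : ℕ :=
  #((column F j).filter fun i : Fin n => (i : ℕ) < r)

theorem highDigits_mono {k l : ℕ} (hkl : k ≤ l) {y z : Fin n →₀ ℕ}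
    (h : highDigits k y ≤ highDigits k z) : highDigits l y ≤ highDigits l z := by
  obtain ⟨m, rfl⟩ := Nat.exists_eq_add_of_le hkl
  rw [← highDigits_highDigits, ← highDigits_highDigits]
  exact fun i => Nat.div_le_div_right (h i)

theorem exists_highDigits_eq_zero (e : Fin n →₀ ℕ) : ∃ L, ∀ l, L ≤ l → highDigits l e = 0 := by
  refine ⟨e.degree, fun l hl => Finsupp.ext fun i => Nat.div_eq_of_lt ?_⟩
  exact ((Finsupp.le_degree i e).trans hl).trans_lt Nat.lt_two_pow_self

theorem toColex_omega_lt_of_highDigits_lt {k : ℕ} {y z : Fin n →₀ ℕ}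
    (h : highDigits k y < highDigits k z) :
    toColex (omega (block y)) < toColex (omega (block z)) := by
  have hex : ∃ l, highDigits (k + l) y = highDigits (k + l) z := by
    obtain ⟨L, hL⟩ := exists_highDigits_eq_zero y
    obtain ⟨M, hM⟩ := exists_highDigits_eq_zero z
    exact ⟨L + M, by rw [hL _ (by lia), hM _ (by lia)]⟩
  obtain ⟨m, hlt, heq⟩ : ∃ m, highDigits m y < highDigits m z ∧
      highDigits (m + 1) y = highDigits (m + 1) z := by
    classical
    obtain ⟨l, hl⟩ := Nat.exists_eq_succ_of_ne_zero (n := Nat.find hex) fun h0 =>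
      h.ne (by simpa [h0] using Nat.find_spec hex)
    have hne := Nat.find_min hex (m := l) (by lia)
    exact ⟨k + l, (highDigits_mono (by lia) h.le).lt_of_ne hne,
      by simpa [hl, add_assoc] using Nat.find_spec hex⟩
  refine ⟨m, fun j hj => ?_, ?_⟩
  · obtain ⟨i, rfl⟩ := Nat.exists_eq_add_of_le (Nat.succ_le_of_lt hj)
    simp only [Pi.toColex_apply, Nat.succ_eq_add_one, ← omega_block_highDigits, heq]
  · obtain ⟨u, hu⟩ := exists_add_of_le hlt.le
    have hu0 : u.degree ≠ 0 := fun h0 =>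
      hlt.ne (by rw [hu, (Finsupp.degree_eq_zero_iff u).1 h0, add_zero])
    have hdeg := congrArg Finsupp.degree hu
    rw [map_add, degree_highDigits m y, degree_highDigits m z, heq] at hdeg
    simp only [Pi.toColex_apply]
    lia

/-- The exponents of `(∏_{i ∈ W} x_i) ^ (2 ^ k)`. -/
noncomputable def twoPowOn (k : ℕ) (W : Finset (Fin n)) : Fin n →₀ ℕ :=
  ∑ i ∈ W, Finsupp.single i (2 ^ k)

theorem twoPowOn_apply (k : ℕ) (W : Finset (Fin n)) (i : Fin n) :
    twoPowOn k W i = if i ∈ W then 2 ^ k else 0 := by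
  simp [twoPowOn, Finsupp.finsetSum_apply, Finsupp.single_apply]

theorem degree_twoPowOn (k : ℕ) (W : Finset (Fin n)) : (twoPowOn k W).degree = 2 ^ k * #W := by
  simp [twoPowOn, map_sum, mul_comm]

theorem twoPowOn_union {k : ℕ} {W Z : Finset (Fin n)} (h : Disjoint W Z) :
    twoPowOn k (W ∪ Z) = twoPowOn k W + twoPowOn k Z :=
  sum_union h

theorem twoPowOn_injective (k : ℕ) : Function.Injective (twoPowOn (n := n) k) := by
  intro W Z h
  ext i
  have hi := DFunLike.congr_fun h i
  have hpos := Nat.two_pow_pos k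
  rw [twoPowOn_apply, twoPowOn_apply] at hi
  split_ifs at hi with hW hZ hZ
  · simp only [hW, hZ]
  · lia
  · lia
  · simp only [hW, hZ]

theorem two_pow_dvd_twoPowOn (k : ℕ) (W : Finset (Fin n)) (i : Fin n) : 2 ^ k ∣ twoPowOn k W i := by
  rw [twoPowOn_apply]
  split_ifs <;> simp

/-- The rows of the block of `e` with the digits `1, 0` in columns `k`, `k + 1`. -/
def exchangeRows (k : ℕ) (e : Fin n →₀ ℕ) : Finset (Fin n) :=
  column (block e) k \ column (block e) (k + 1)

/-- The rows of the block of `e` with the digits `0, 1` in columns `k`, `k + 1`: adding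
`2 ^ k` to the exponent of a row with the digits `1, 0` produces these. -/
def raisedRows (k : ℕ) (e : Fin n →₀ ℕ) : Finset (Fin n) :=
  column (block e) (k + 1) \ column (block e) k

theorem mem_exchangeRows {k : ℕ} {e : Fin n →₀ ℕ} {i : Fin n} :
    i ∈ exchangeRows k e ↔ e i / 2 ^ k % 4 = 1 := by
  simp only [exchangeRows, mem_sdiff, mem_column, block, Nat.testBit_eq_decide_div_mod_eq,
    decide_eq_true_eq, pow_succ, ← Nat.div_div_eq_div_mul]
  lia

theorem mem_raisedRows {k : ℕ} {e : Fin n →₀ ℕ} {i : Fin n} :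
    i ∈ raisedRows k e ↔ e i / 2 ^ k % 4 = 2 := by
  simp only [raisedRows, mem_sdiff, mem_column, block, Nat.testBit_eq_decide_div_mod_eq,
    decide_eq_true_eq, pow_succ, ← Nat.div_div_eq_div_mul]
  lia

theorem card_exchangeRows_lt_card_raisedRows {k ρ : ℕ} {e : Fin n →₀ ℕ}
    (h : topCount (block e) ρ k < topCount (block e) ρ (k + 1)) :
    #{i ∈ exchangeRows k e | i.1 < ρ} < #{i ∈ raisedRows k e | i.1 < ρ} := by
  have hsdiff (s t : Finset (Fin n)) :
      {i ∈ s \ t | i.1 < ρ} = {i ∈ s | i.1 < ρ} \ {i ∈ t | i.1 < ρ} := by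
    grind
  rw [exchangeRows, raisedRows, hsdiff, hsdiff]
  exact card_sdiff_lt_card_sdiff_iff.2 h

theorem add_twoPowOn_div (k : ℕ) (e : Fin n →₀ ℕ) (W : Finset (Fin n)) (i : Fin n) :
    (e + twoPowOn k W) i / 2 ^ k = e i / 2 ^ k + if i ∈ W then 1 else 0 := by
  rw [Finsupp.add_apply, twoPowOn_apply]
  split_ifs
  · exact Nat.add_div_right _ (Nat.two_pow_pos k)
  · rw [add_zero, add_zero]

theorem exchangeRows_add_twoPowOn {k : ℕ} {e : Fin n →₀ ℕ} {W : Finset (Fin n)}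
    (hW : W ⊆ exchangeRows k e) : exchangeRows k (e + twoPowOn k W) = exchangeRows k e \ W := by
  ext i
  have := @hW i
  rw [mem_exchangeRows] at this
  rw [mem_sdiff, mem_exchangeRows, mem_exchangeRows, add_twoPowOn_div]
  split_ifs with hi <;> simp only [hi, true_implies, not_true, not_false_eq_true] at * <;> lia

theorem highDigits_add_twoPowOn {k : ℕ} {e : Fin n →₀ ℕ} {W : Finset (Fin n)}
    (hW : W ⊆ exchangeRows k e) : highDigits (k + 2) (e + twoPowOn k W) = highDigits (k + 2) e := by
  ext i
  have := @hW i
  rw [mem_exchangeRows] at this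
  have hdiv (x : ℕ) : x / 2 ^ (k + 2) = x / 2 ^ k / 4 := by
    rw [pow_add, ← Nat.div_div_eq_div_mul, show 2 ^ 2 = 4 from rfl]
  simp only [highDigits, Finsupp.mapRange_apply, hdiv, add_twoPowOn_div]
  split_ifs with hi
  · have := this hi
    lia
  · rw [add_zero]

theorem column_add_twoPowOn {k : ℕ} {e : Fin n →₀ ℕ} {W : Finset (Fin n)}
    (hW : W ⊆ exchangeRows k e) : column (block (e + twoPowOn k W)) k = column (block e) k \ W := by
  ext i
  have hi : i ∈ W → (e i).testBit k = true := fun h =>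
    mem_column.1 (mem_sdiff.1 (hW h)).1
  rw [mem_sdiff, mem_column, mem_column, block, block, Finsupp.add_apply,
    testBit_add_of_dvd _ (two_pow_dvd_twoPowOn k W i), twoPowOn_apply]
  split_ifs with hiW <;> simp [hiW, hi]

theorem omega_add_twoPowOn_eq {k : ℕ} {e : Fin n →₀ ℕ} {W Z : Finset (Fin n)}
    (hW : W ⊆ exchangeRows k e) (hZ : Z ⊆ exchangeRows k e) (hcard : #W = #Z) :
    omega (block (e + twoPowOn k W)) = omega (block (e + twoPowOn k Z)) := by
  have hlow (j : ℕ) (hj : j < k) :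
      omega (block (e + twoPowOn k W)) j = omega (block (e + twoPowOn k Z)) j := by
    rw [omega_block_add_of_dvd e (two_pow_dvd_twoPowOn k W) hj,
      omega_block_add_of_dvd e (two_pow_dvd_twoPowOn k Z) hj]
  have hk : omega (block (e + twoPowOn k W)) k = omega (block (e + twoPowOn k Z)) k := by
    rw [omega, omega, column_add_twoPowOn hW, column_add_twoPowOn hZ,
      card_sdiff_of_subset (hW.trans sdiff_subset), card_sdiff_of_subset (hZ.trans sdiff_subset),
      hcard]
  have hhigh : highDigits (k + 2) (e + twoPowOn k W) = highDigits (k + 2) (e + twoPowOn k Z) := by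
    rw [highDigits_add_twoPowOn hW, highDigits_add_twoPowOn hZ]
  -- Column `k + 1` is then determined by the degree.
  have hdeg : (e + twoPowOn k W).degree = (e + twoPowOn k Z).degree := by
    rw [map_add, map_add, degree_twoPowOn, degree_twoPowOn, hcard]
  rw [degree_eq_sum_add_highDigits (k + 2) (e + twoPowOn k W),
    degree_eq_sum_add_highDigits (k + 2) (e + twoPowOn k Z), hhigh, sum_range_succ, sum_range_succ,
    sum_range_succ, sum_range_succ, hk,
    sum_congr rfl fun j hj => by rw [hlow j (mem_range.1 hj)], Nat.add_right_cancel_iff,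
    Nat.add_left_cancel_iff, Nat.mul_left_inj (by positivity)] at hdeg
  funext j
  rcases lt_trichotomy j k with hj | rfl | hj
  · exact hlow j hj
  · exact hk
  rcases (Nat.succ_le_of_lt hj).eq_or_lt with rfl | hj
  · exact hdeg
  obtain ⟨l, rfl⟩ := Nat.exists_eq_add_of_le (Nat.succ_le_of_lt hj)
  simpa only [omega_block_highDigits] using congrArg (fun e => omega (block e) l) hhigh

theorem exists_add_twoPowOn_raisedRows (k : ℕ) (e : Fin n →₀ ℕ) :
    ∃ r, r + twoPowOn k (raisedRows k e) = e ∧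
      exchangeRows k r = raisedRows k e ∪ exchangeRows k e := by
  set B := raisedRows k e
  have hmem (i : Fin n) : i ∈ B ↔ e i / 2 ^ k % 4 = 2 := mem_raisedRows
  have hle : twoPowOn k B ≤ e := fun i => by
    rw [twoPowOn_apply]
    split_ifs with hi
    · rw [hmem] at hi
      exact (Nat.div_pos_iff.1 (by lia : 0 < e i / 2 ^ k)).2
    · exact Nat.zero_le _
  obtain ⟨r, hr⟩ := exists_add_of_le hle
  rw [add_comm] at hr
  refine ⟨r, hr.symm, ?_⟩
  ext i
  have hi := hmem i
  have hdiv := add_twoPowOn_div k r B i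
  rw [← hr] at hdiv
  rw [mem_union, mem_exchangeRows, mem_exchangeRows]
  split_ifs at hdiv with hiB <;> simp only [hiB, true_iff, false_iff] at hi ⊢ <;> lia

theorem eq_two_pow_of_add_div_le {k x t : ℕ} (hdvd : 2 ^ k ∣ t)
    (hsub : ∀ j, t.testBit j = true → x.testBit j = true) (ht : t ≠ 0)
    (hle : (x + t) / 2 ^ (k + 2) ≤ x / 2 ^ (k + 2)) : t = 2 ^ k ∧ x / 2 ^ k % 4 = 1 := by
  obtain ⟨s, rfl⟩ := hdvd
  have hbit (j : ℕ) (hj : s.testBit j = true) : (x / 2 ^ k).testBit j = true := by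
    rw [Nat.testBit_div_two_pow]
    exact hsub _ (by simpa [Nat.testBit_two_pow_mul] using hj)
  have hbit₀ := hbit 0
  have hbit₁ := hbit 1
  rw [pow_add, ← Nat.div_div_eq_div_mul, ← Nat.div_div_eq_div_mul,
    Nat.add_mul_div_left _ _ (Nat.two_pow_pos k)] at hle
  have hs : s ≠ 0 := right_ne_zero_of_mul ht
  simp only [Nat.testBit_eq_decide_div_mod_eq, decide_eq_true_eq] at hbit₀ hbit₁
  obtain rfl : s = 1 := by lia
  exact ⟨mul_one _, by lia⟩

theorem eq_twoPowOn_support {k : ℕ} {f t : Fin n →₀ ℕ} (hdvd : ∀ i, 2 ^ k ∣ t i)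
    (hle : block t ≤ block f) (hhigh : ¬ highDigits (k + 2) f < highDigits (k + 2) (f + t)) :
    t = twoPowOn k t.support ∧ t.support ⊆ exchangeRows k f := by
  have heq : highDigits (k + 2) f = highDigits (k + 2) (f + t) :=
    eq_of_le_of_not_lt (fun i => Nat.div_le_div_right (Nat.le_add_right _ _)) hhigh
  have hrow (i : Fin n) (hi : t i ≠ 0) : t i = 2 ^ k ∧ f i / 2 ^ k % 4 = 1 :=
    eq_two_pow_of_add_div_le (hdvd i) (block_le_block.1 hle i) hi (DFunLike.congr_fun heq i).ge
  refine ⟨Finsupp.ext fun i => ?_, fun i hi =>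
    mem_exchangeRows.2 (hrow i (Finsupp.mem_support_iff.1 hi)).2⟩
  rw [twoPowOn_apply]
  split_ifs with hi
  · exact (hrow i (Finsupp.mem_support_iff.1 hi)).1
  · exact Finsupp.notMem_support_iff.1 hi

theorem sum_monomial_add_twoPowOn_mem {f : Fin n →₀ ℕ} {d k m : ℕ} (hm : 0 < m)
    (hd : f.degree + 2 ^ k * m = d)
    (hpre : ∀ w, IsDescendingOmega n d w → ∀ j < k, w j = omega (block f) j) :
    ∑ W ∈ powersetCard m (exchangeRows k f), monomial (f + twoPowOn k W) 1 ∈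
      hitsOfDegree n d ⊔ monoSpan d fun e => highDigits (k + 2) f < highDigits (k + 2) e := by
  set S := (powersetCard m (exchangeRows k f)).image (twoPowOn k) with hS
  have hsub : S ⊆ sqTerms f (2 ^ k * m) := by
    intro t ht
    obtain ⟨W, hW, rfl⟩ := mem_image.1 ht
    obtain ⟨hWf, rfl⟩ := mem_powersetCard.1 hW
    refine mem_sqTerms.2 ⟨degree_twoPowOn k W, block_le_block.2 fun i j hij => ?_⟩
    rw [twoPowOn_apply] at hij
    split_ifs at hij with hi
    · rw [Nat.testBit_two_pow, decide_eq_true_eq] at hij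
      exact hij ▸ mem_column.1 (mem_sdiff.1 (hWf hi)).1
    · simp at hij
  have hhit := Sq_monomial_mem_hitsOfDegree (by positivity) hd
  rw [Sq_monomial, ← sum_sdiff hsub, hS, sum_image (twoPowOn_injective k).injOn] at hhit
  refine (Submodule.add_mem_iff_right _ (sum_mem fun t ht => ?_)).1 (Submodule.mem_sup_left hhit)
  rw [mem_sdiff, mem_sqTerms] at ht
  obtain ⟨⟨htdeg, htle⟩, htS⟩ := ht
  have hdeg : (f + t).degree = d := by rw [map_add, htdeg, hd]
  by_cases hdvd : ∀ i, 2 ^ k ∣ t i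
  · refine Submodule.mem_sup_right (monomial_mem_monoSpan hdeg (by_contra fun hhigh => htS ?_))
    obtain ⟨htW, hWf⟩ := eq_twoPowOn_support hdvd htle hhigh
    refine mem_image.2 ⟨t.support, mem_powersetCard.2 ⟨hWf, ?_⟩, htW.symm⟩
    rw [htW, degree_twoPowOn] at htdeg
    exact Nat.eq_of_mul_eq_mul_left (Nat.two_pow_pos k) htdeg
  · obtain ⟨c, hck, heq, hlt⟩ := lowerBefore_add htle (not_forall.1 hdvd) (y := 0) (by simp)
    rw [add_zero] at heq hlt
    refine Submodule.mem_sup_left (monomial_mem_hitsOfDegree_of_lex_lt hdeg fun w hw => ?_)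
    exact ⟨c, fun j hj => (heq j hj).trans (hpre w hw j (hj.trans hck)).symm,
      hlt.trans_eq (hpre w hw c hck).symm⟩

theorem sum_monomial_add_twoPowOn_subset_mem {r : Fin n →₀ ℕ} {d k m : ℕ} {Z₀ : Finset (Fin n)}
    (hZ₀ : Z₀ ⊆ exchangeRows k r) (hm : #Z₀ < m) (hd : r.degree + 2 ^ k * m = d)
    (hpre : ∀ w, IsDescendingOmega n d w → ∀ j < k, w j = omega (block r) j) :
    ∑ Z ∈ powersetCard m (exchangeRows k r) with Z₀ ⊆ Z, monomial (r + twoPowOn k Z) 1 ∈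
      hitsOfDegree n d ⊔ monoSpan d fun e => highDigits (k + 2) r < highDigits (k + 2) e := by
  have hdeg : (r + twoPowOn k Z₀).degree + 2 ^ k * (m - #Z₀) = d := by
    rw [map_add, degree_twoPowOn, add_assoc, ← mul_add, Nat.add_sub_cancel' hm.le, hd]
  have hsum := sum_monomial_add_twoPowOn_mem (Nat.sub_pos_of_lt hm) hdeg fun w hw j hj => by
    rw [hpre w hw j hj, omega_block_add_of_dvd r (two_pow_dvd_twoPowOn k Z₀) hj]
  rw [exchangeRows_add_twoPowOn hZ₀, highDigits_add_twoPowOn hZ₀] at hsum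
  have hdisj {W : Finset (Fin n)} (hW : W ∈ powersetCard (m - #Z₀) (exchangeRows k r \ Z₀)) :
      Disjoint W Z₀ := disjoint_sdiff.symm.mono_left (mem_powersetCard.1 hW).1
  rw [filter_powersetCard_subset _ _ _ hZ₀ hm.le, sum_image fun W hW W' hW' h => by
    rw [← union_sdiff_cancel_right (hdisj hW), h, union_sdiff_cancel_right (hdisj hW')]]
  convert hsum using 3 with W hW
  rw [add_assoc, union_comm, twoPowOn_union (hdisj hW).symm]

theorem sum_powerset_sum_filter_subset {α M : Type*} [DecidableEq α] [AddCommMonoid M]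
    [Module (ZMod 2) M] (X : Finset α) (𝒮 : Finset (Finset α)) (f : Finset α → M) :
    ∑ W ∈ X.powerset, ∑ Z ∈ 𝒮 with W ⊆ Z, f Z = ∑ Z ∈ 𝒮 with Disjoint Z X, f Z := by
  simp only [sum_filter]
  rw [sum_comm]
  refine sum_congr rfl fun Z _ => ?_
  have hcount : {W ∈ X.powerset | W ⊆ Z} = (Z ∩ X).powerset := by
    ext W
    simp only [mem_filter, mem_powerset, subset_inter_iff, and_comm]
  rw [← sum_filter, hcount, sum_const, card_powerset, ← Nat.cast_smul_eq_nsmul (ZMod 2),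
    Nat.cast_pow, Nat.cast_ofNat, show (2 : ZMod 2) = 0 from rfl, zero_pow_eq, ite_smul, one_smul,
    zero_smul]
  simp only [card_eq_zero, disjoint_iff_inter_eq_empty]

theorem toColex_add_twoPowOn_lt {k : ℕ} {r : Fin n →₀ ℕ} {B Z : Finset (Fin n)}
    (hcard : #Z = #B) (hne : Z ≠ B) (hlt : ∀ i ∈ B \ Z, ∀ j ∈ Z \ B, i < j) :
    toColex ⇑(r + twoPowOn k B) < toColex ⇑(r + twoPowOn k Z) := by
  have hnonempty : (Z \ B).Nonempty :=
    sdiff_nonempty.2 fun hsub => hne (eq_of_subset_of_card_le hsub hcard.ge)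
  set top := (Z \ B).max' hnonempty with htop
  obtain ⟨hZ, hB⟩ := mem_sdiff.1 ((Z \ B).max'_mem hnonempty)
  refine ⟨top, fun j hj => ?_, ?_⟩
  · have hiff : j ∈ B ↔ j ∈ Z := by
      refine ⟨fun hjB => by_contra fun hjZ => ?_, fun hjZ => by_contra fun hjB => ?_⟩
      · exact hj.not_gt (hlt j (mem_sdiff.2 ⟨hjB, hjZ⟩) top (mem_sdiff.2 ⟨hZ, hB⟩))
      · exact hj.not_ge (le_max' _ _ (mem_sdiff.2 ⟨hjZ, hjB⟩))
    simp only [Pi.toColex_apply, Finsupp.add_apply, twoPowOn_apply, hiff]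
  · simp only [Pi.toColex_apply, Finsupp.add_apply, twoPowOn_apply, htop, if_pos hZ, if_neg hB]
    exact Nat.add_lt_add_left (Nat.two_pow_pos k) _

theorem sum_monomial_add_twoPowOn_disjoint_mem {r : Fin n →₀ ℕ} {d k m : ℕ}
    {Z₀ X : Finset (Fin n)} (hZ₀ : Z₀ ⊆ exchangeRows k r) (hX : X ⊆ exchangeRows k r)
    (hm : #Z₀ + #X < m) (hd : r.degree + 2 ^ k * m = d)
    (hpre : ∀ w, IsDescendingOmega n d w → ∀ j < k, w j = omega (block r) j) :
    ∑ Z ∈ powersetCard m (exchangeRows k r) with Z₀ ⊆ Z ∧ Disjoint Z X,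
        monomial (r + twoPowOn k Z) 1 ∈
      hitsOfDegree n d ⊔ monoSpan d fun e => highDigits (k + 2) r < highDigits (k + 2) e := by
  -- By inclusion-exclusion mod 2, it suffices to sum over the `Z ⊇ Z₀ ∪ W` for each `W ⊆ X`.
  rw [← filter_filter, ← sum_powerset_sum_filter_subset]
  refine sum_mem fun W hW => ?_
  have hWX := mem_powerset.1 hW
  rw [filter_filter]
  simp only [← union_subset_iff]
  refine sum_monomial_add_twoPowOn_subset_mem (union_subset hZ₀ (hWX.trans hX)) ?_ hd hpre
  exact ((card_union_le _ _).trans (Nat.add_le_add_left (card_le_card hWX) _)).trans_lt hm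

/-- The monomials are compared by their `ω`-vectors and then by their exponents, both in the
colexicographic order. -/
def colexKey (e : Fin n →₀ ℕ) : Colex (ℕ → ℕ) ×ₗ Colex (Fin n → ℕ) :=
  toLex (toColex (omega (block e)), toColex ⇑e)

/-- The polynomials of degree `d` spanned by hit polynomials and by the monomials above `e` in the
order of `colexKey`. -/
noncomputable def hitsSupAbove (d : ℕ) (e : Fin n →₀ ℕ) : Submodule (ZMod 2) (P n) :=
  hitsOfDegree n d ⊔ monoSpan d fun e' => colexKey e < colexKey e'

theorem colexKey_add_twoPowOn_lt {k : ℕ} {r : Fin n →₀ ℕ} {B Z : Finset (Fin n)}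
    (hB : B ⊆ exchangeRows k r) (hZ : Z ⊆ exchangeRows k r) (hcard : #Z = #B) (hne : Z ≠ B)
    (hlt : ∀ i ∈ B \ Z, ∀ j ∈ Z \ B, i < j) :
    colexKey (r + twoPowOn k B) < colexKey (r + twoPowOn k Z) :=
  Prod.Lex.toLex_lt_toLex.2 <| Or.inr
    ⟨congrArg toColex (omega_add_twoPowOn_eq hB hZ hcard.symm),
      toColex_add_twoPowOn_lt hcard hne hlt⟩

theorem hitsOfDegree_sup_highDigits_le_hitsSupAbove (d k : ℕ) (e : Fin n →₀ ℕ) :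
    (hitsOfDegree n d ⊔ monoSpan d fun e' => highDigits k e < highDigits k e') ≤
      hitsSupAbove d e :=
  sup_le_sup_left (monoSpan_le fun _ hd hlt => monomial_mem_monoSpan hd <|
    Prod.Lex.toLex_lt_toLex.2 (Or.inl (toColex_omega_lt_of_highDigits_lt hlt))) _

theorem monomial_mem_hitsSupAbove {e : Fin n →₀ ℕ} {d k ρ : ℕ} (hd : e.degree = d)
    (hpre : ∀ w, IsDescendingOmega n d w → ∀ j < k, w j = omega (block e) j)
    (hρ : topCount (block e) ρ k < topCount (block e) ρ (k + 1)) :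
    monomial e 1 ∈ hitsSupAbove d e := by
  set B := raisedRows k e
  set X := {i ∈ exchangeRows k e | i.1 < ρ}
  set B₀ := {i ∈ B | ¬ i.1 < ρ}
  obtain ⟨r, hre, hrows⟩ := exists_add_twoPowOn_raisedRows k e
  have hBr : B ⊆ exchangeRows k r := hrows ▸ subset_union_left
  have hcard : #B₀ + #X < #B := by
    rw [← card_filter_add_card_filter_not (s := B) fun i => i.1 < ρ, add_comm]
    exact Nat.add_lt_add_right (card_exchangeRows_lt_card_raisedRows hρ) _
  have hdeg : r.degree + 2 ^ k * #B = d := by rw [← hd, ← hre, map_add, degree_twoPowOn]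
  have hsum := sum_monomial_add_twoPowOn_disjoint_mem ((filter_subset _ _).trans hBr)
    ((filter_subset _ _).trans (hrows ▸ subset_union_right)) hcard hdeg fun w hw j hj => by
      rw [hpre w hw j hj, ← hre, omega_block_add_of_dvd r (two_pow_dvd_twoPowOn k B) hj]
  rw [← highDigits_add_twoPowOn hBr, hre] at hsum
  replace hsum := hitsOfDegree_sup_highDigits_le_hitsSupAbove d (k + 2) e hsum
  have hBX : Disjoint B X := by
    refine disjoint_left.2 fun i hi hiX => ?_
    rw [mem_raisedRows] at hi
    have := mem_exchangeRows.1 (mem_filter.1 hiX).1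
    lia
  rw [← add_sum_erase (a := B) _ _ (by simpa [hBr] using hBX), hre] at hsum
  refine (Submodule.add_mem_iff_left _ (sum_mem fun Z hZ => Submodule.mem_sup_right ?_)).1 hsum
  simp only [mem_erase, mem_filter, mem_powersetCard] at hZ
  obtain ⟨hne, ⟨hZr, hZcard⟩, hB₀Z, hZX⟩ := hZ
  refine monomial_mem_monoSpan (by rw [map_add, degree_twoPowOn, hZcard, hdeg]) ?_
  nth_rw 1 [← hre]
  refine colexKey_add_twoPowOn_lt hBr hZr hZcard hne fun i hi j hj => ?_
  obtain ⟨hiB, hiZ⟩ := mem_sdiff.1 hi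
  obtain ⟨hjZ, hjB⟩ := mem_sdiff.1 hj
  have hiρ : i.1 < ρ := by_contra fun h => hiZ (hB₀Z (mem_filter.2 ⟨hiB, h⟩))
  have hjρ : ¬ j.1 < ρ := fun h => disjoint_left.1 hZX hjZ <|
    mem_filter.2 ⟨(mem_union.1 (hrows ▸ hZr hjZ)).resolve_left hjB, h⟩
  exact hiρ.trans_le (not_lt.1 hjρ)

/-! ### Semistandard blocks span the cohits -/

theorem omega_firstRows (F : BinArray n) {r : ℕ} (hr : r ≤ n) (j : ℕ) :
    omega (firstRows F r hr) j = topCount F r j := by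
  rw [omega, ← card_map (Fin.castLEEmb hr), topCount]
  congr 1
  ext i
  rw [mem_map, mem_filter]
  constructor
  · rintro ⟨a, ha, rfl⟩
    exact ⟨mem_column.2 (mem_column.1 ha :), a.2⟩
  · rintro ⟨hi, hir⟩
    exact ⟨⟨i, hir⟩, mem_column.2 (mem_column.1 hi :), rfl⟩

theorem topCount_of_le (F : BinArray n) {r : ℕ} (hr : n ≤ r) (j : ℕ) :
    topCount F r j = omega F j :=
  congrArg card (filter_true_of_mem fun i _ => i.2.trans_le hr)

theorem isSemistandard_iff {F : BinArray n} : IsSemistandard F ↔ ∀ r, Antitone (topCount F r) := by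
  refine ⟨fun h r => ?_, fun h r hr _ => by simpa only [funext (omega_firstRows F hr)] using h r⟩
  have hle (r : ℕ) (hr : r ≤ n) : Antitone (topCount F r) := by
    rcases Nat.eq_zero_or_pos r with rfl | hpos
    · intro j k _
      simp [topCount]
    · simpa only [funext (omega_firstRows F hr)] using h r hr hpos
  rcases le_total r n with hr | hr
  · exact hle r hr
  · have hn := hle n le_rfl
    rwa [funext (topCount_of_le F le_rfl), ← funext (topCount_of_le F hr)] at hn

theorem IsSemistandard.antitone_omega {F : BinArray n} (h : IsSemistandard F) :
    Antitone (omega F) :=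
  funext (topCount_of_le F le_rfl) ▸ isSemistandard_iff.1 h n

theorem exists_omega_lt_omega_succ {d k : ℕ} {w : ℕ → ℕ} (hw : IsDescendingOmega n d w)
    (huniq : ∀ v, IsDescendingOmega n d v → v = w) {e : Fin n →₀ ℕ} (hd : e.degree = d)
    (heq : ∀ j < k, w j = omega (block e) j) (hlt : w k < omega (block e) k) :
    ∃ l, k = l + 1 ∧ omega (block e) l < omega (block e) (l + 1) := by
  subst hd
  by_contra! hno
  obtain ⟨v, hv, hve⟩ := exists_isDescendingOmega_of_lt hw (fun j hj => (heq j hj).symm) hlt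
    fun j hj => by
      rcases (Nat.succ_le_of_lt hj).eq_or_lt with hjk | hjk
      · exact hno j hjk.symm
      · rw [← heq j hj, ← heq (j + 1) hjk]
        exact hw.1 j.le_succ
  exact hlt.ne (by rw [← hve k le_rfl, huniq v hv])

theorem monomial_mem_hitsOfDegree_sup_semistandard {d : ℕ}
    (hw : ∃! w, IsDescendingOmega n d w) {e : Fin n →₀ ℕ} (hd : e.degree = d) :
    monomial e 1 ∈ hitsOfDegree n d ⊔ monoSpan d fun e => IsSemistandard (block e) := by
  obtain ⟨w, hw, huniq⟩ := hw
  refine degree_induction (fun e => OrderDual.toDual (colexKey e)) (q := fun e => monomial e 1 ∈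
    hitsOfDegree n d ⊔ monoSpan d fun e => IsSemistandard (block e)) (fun e hd ih => ?_) hd
  have hprefix {k : ℕ} (h : ∀ j < k, w j = omega (block e) j) (v : ℕ → ℕ)
      (hv : IsDescendingOmega n d v) : ∀ j < k, v j = omega (block e) j := huniq v hv ▸ h
  have hsmaller : hitsSupAbove d e ≤
      hitsOfDegree n d ⊔ monoSpan d fun e => IsSemistandard (block e) :=
    sup_le le_sup_left (monoSpan_le ih)
  rcases lt_trichotomy (toLex (omega (block e))) (toLex w) with hlt | heq | ⟨k, heq, hlt⟩
  · refine Submodule.mem_sup_left (monomial_mem_hitsOfDegree_of_lex_lt hd fun v hv => ?_)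
    rwa [huniq v hv]
  · by_cases hss : IsSemistandard (block e)
    · exact Submodule.mem_sup_right (monomial_mem_monoSpan hd hss)
    · obtain ⟨ρ, k, hρ⟩ : ∃ ρ k, topCount (block e) ρ k < topCount (block e) ρ (k + 1) := by
        by_contra! hanti
        exact hss (isSemistandard_iff.2 fun ρ => antitone_nat_of_succ_le (hanti ρ))
      exact hsmaller <| monomial_mem_hitsSupAbove hd
        (hprefix fun j _ => (congrFun (toLex_inj.1 heq) j).symm) hρ
  · obtain ⟨l, rfl, hl⟩ := exists_omega_lt_omega_succ hw huniq hd heq hlt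
    refine hsmaller <| monomial_mem_hitsSupAbove (ρ := n) hd
      (hprefix fun j hj => heq j (hj.trans l.lt_succ_self)) ?_
    rwa [topCount_of_le _ le_rfl, topCount_of_le _ le_rfl]

theorem homog_le_hits_sup_semistandard {d : ℕ} (hw : ∃! w, IsDescendingOmega n d w) :
    homog n d ≤ hits n ⊔ monoSpan d fun e => IsSemistandard (block e) := by
  intro f hf
  rw [f.as_sum]
  refine Submodule.sum_mem _ fun e he => ?_
  have hdeg : e.degree = d := by
    rw [Finsupp.degree_eq_weight_one]
    exact hf (mem_support_iff.1 he)
  rw [← mul_one (f.coeff e), ← smul_eq_mul, ← smul_monomial]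
  exact Submodule.smul_mem _ _ (sup_le_sup_right (hitsOfDegree_le_hits n d) _
    (monomial_mem_hitsOfDegree_sup_semistandard hw hdeg))

theorem span_monomialClass_eq_top {d : ℕ} {p : (Fin n →₀ ℕ) → Prop}
    (h : homog n d ≤ hits n ⊔ monoSpan d p) :
    Submodule.span (ZMod 2)
      {q : Cohits n d | ∃ (e : Fin n →₀ ℕ) (he : e.degree = d), p e ∧ q = monomialClass e he} =
        ⊤ := by
  set V := Submodule.span (ZMod 2)
    {q : Cohits n d | ∃ (e : Fin n →₀ ℕ) (he : e.degree = d), p e ∧ q = monomialClass e he}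
  have hlift : monoSpan d p ≤ (V.comap (Submodule.mkQ _)).map (homog n d).subtype :=
    monoSpan_le fun e he hp => ⟨⟨monomial e 1, isHomogeneous_monomial 1 he⟩,
      Submodule.subset_span ⟨e, he, hp, rfl⟩, rfl⟩
  rw [eq_top_iff]
  rintro q -
  obtain ⟨⟨f, hf⟩, rfl⟩ := Submodule.Quotient.mk_surjective _ q
  obtain ⟨h, hh, g, hg, rfl⟩ := Submodule.mem_sup.1 (h hf)
  obtain ⟨g, hgV, rfl⟩ := hlift hg
  have hclass : (Submodule.Quotient.mk ⟨h + g, hf⟩ : Cohits n d) = Submodule.Quotient.mk g := by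
    rw [Submodule.Quotient.eq, Submodule.submoduleOf, Submodule.mem_comap]
    simpa using hh
  exact hclass ▸ hgV

theorem rank_cohits_le {d : ℕ} {p : (Fin n →₀ ℕ) → Prop}
    (hspan : Submodule.span (ZMod 2) {q : Cohits n d | ∃ (e : Fin n →₀ ℕ) (he : e.degree = d),
      p e ∧ q = monomialClass e he} = ⊤) :
    Module.rank (ZMod 2) (Cohits n d) ≤ Cardinal.mk {e : Fin n →₀ ℕ | e.degree = d ∧ p e} := by
  rw [← rank_top, ← hspan]
  refine (rank_span_le _).trans <| (Cardinal.mk_le_mk_of_subset ?_).trans <|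
    Cardinal.mk_range_le (f := fun e : {e : Fin n →₀ ℕ | e.degree = d ∧ p e} =>
      monomialClass e.1 e.2.1)
  rintro _ ⟨e, he, hp, rfl⟩
  exact ⟨⟨e, he, hp⟩, rfl⟩

/-! ### Column-position arrays -/

-- The definition of `cp` coerces the sorted list to a `List ℕ` by a monadic bind.
theorem cp_eq_getD_map (F : BinArray n) (i j : ℕ) :
    cp F i j = (((column F j).sort (· ≤ ·)).map fun r : Fin n => (r : ℕ) + 1).getD i 0 := by
  simp only [cp, List.bind_eq_flatMap, List.pure_def, ← List.map_eq_flatMap, List.map_map,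
    Function.comp_def]

theorem cp_of_lt {F : BinArray n} {i j : ℕ} (h : i < omega F j) :
    cp F i j = ((column F j).orderEmbOfFin rfl ⟨i, h⟩ : ℕ) + 1 := by
  have hcard : i < #(column F j) := h
  simp [cp_eq_getD_map, hcard, orderEmbOfFin_apply]

theorem cp_of_le {F : BinArray n} {i j : ℕ} (h : omega F j ≤ i) : cp F i j = 0 := by
  have hcard : #(column F j) ≤ i := h
  simp [cp_eq_getD_map, hcard]

theorem lt_iff_lt_card_filter_lt {α : Type*} [LinearOrder α] {c : ℕ} {f : Fin c → α}
    (hf : Monotone f) (x : α) (i : Fin c) : f i < x ↔ (i : ℕ) < #{l | f l < x} := by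
  constructor
  · intro hi
    have hsub : Iic i ⊆ ({l | f l < x} : Finset (Fin c)) := fun l hl =>
      mem_filter.2 ⟨mem_univ l, (hf (mem_Iic.1 hl)).trans_lt hi⟩
    simpa only [Fin.card_Iic, Nat.succ_le_iff] using card_le_card hsub
  · contrapose!
    intro hi
    have hsub : ({l | f l < x} : Finset (Fin c)) ⊆ Iio i := fun l hl =>
      mem_Iio.2 (lt_of_not_ge fun hil => (hi.trans (hf hil)).not_gt (mem_filter.1 hl).2)
    simpa only [Fin.card_Iio] using card_le_card hsub

theorem cp_le_iff {F : BinArray n} {i j : ℕ} (h : i < omega F j) (r : ℕ) :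
    cp F i j ≤ r ↔ i < topCount F r j := by
  set f := (column F j).orderEmbOfFin rfl
  have hcount : topCount F r j = #{l | (f l : ℕ) < r} := by
    have hmap : univ.map f.toEmbedding = column F j := map_orderEmbOfFin_univ _ rfl
    calc topCount F r j = #((univ.map f.toEmbedding).filter fun a : Fin n => (a : ℕ) < r) := by
          rw [hmap, topCount]
      _ = #{l | (f l : ℕ) < r} := by
          rw [filter_map, card_map]
          rfl
  rw [cp_of_lt h, Nat.succ_le_iff, hcount]
  exact lt_iff_lt_card_filter_lt (f := fun l => (f l : ℕ)) f.monotone r ⟨i, h⟩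

theorem mem_column_iff_exists_cp_eq {F : BinArray n} {j : ℕ} {a : Fin n} :
    a ∈ column F j ↔ ∃ i, cp F i j = (a : ℕ) + 1 := by
  constructor
  · intro ha
    obtain ⟨l, rfl⟩ : a ∈ Set.range ((column F j).orderEmbOfFin rfl) := by
      rwa [range_orderEmbOfFin]
    exact ⟨l, cp_of_lt l.2⟩
  · rintro ⟨i, hi⟩
    have hlt : i < omega F j := lt_of_not_ge fun hle => by simp [cp_of_le hle] at hi
    rw [cp_of_lt hlt, Nat.add_right_cancel_iff] at hi
    exact Fin.ext hi ▸ orderEmbOfFin_mem _ _ _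

theorem cp_injective : Function.Injective (cp (n := n)) := by
  intro F G h
  funext i j
  have hcol : i ∈ column F j ↔ i ∈ column G j := by
    rw [mem_column_iff_exists_cp_eq, mem_column_iff_exists_cp_eq, h]
  rwa [mem_column, mem_column, ← Bool.eq_iff_iff] at hcol

theorem block_injective : Function.Injective (block (n := n)) := fun _ _ h =>
  Finsupp.ext fun i => Nat.eq_of_testBit_eq (congrFun (congrFun h i))

/-! ### Semistandard blocks and tableaux -/

/-- The tableau `cp F` of a semistandard block `F`. -/
def tableauOfBlock {F : BinArray n} (hF : IsSemistandard F) {μ : YoungDiagram}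
    (hμ : omega F = μ.colLen) : SemistandardYoungTableau μ where
  entry := cp F
  row_weak' {i j₁ j₂} hj hmem := by
    rw [YoungDiagram.mem_iff_lt_colLen, ← hμ] at hmem
    rw [cp_le_iff (hmem.trans_le (hF.antitone_omega hj.le))]
    exact ((cp_le_iff hmem _).1 le_rfl).trans_le (isSemistandard_iff.1 hF _ hj.le)
  col_strict' {i₁ i₂ j} hi hmem := by
    rw [YoungDiagram.mem_iff_lt_colLen, ← hμ] at hmem
    rw [cp_of_lt hmem, cp_of_lt (hi.trans hmem)]
    exact Nat.succ_lt_succ <| ((column F j).orderEmbOfFin rfl).strictMono <|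
      show (⟨i₁, hi.trans hmem⟩ : Fin (omega F j)) < ⟨i₂, hmem⟩ from hi
  zeros' {i j} hmem := by
    rw [YoungDiagram.mem_iff_lt_colLen, ← hμ] at hmem
    exact cp_of_le (not_lt.1 hmem)

theorem isSemistandard_of_cp_eq {F : BinArray n} {μ : YoungDiagram}
    {T : SemistandardYoungTableau μ} (hμ : omega F = μ.colLen) (hT : cp F = T) :
    IsSemistandard F := by
  refine isSemistandard_iff.2 fun r => antitone_nat_of_succ_le fun j => not_lt.1 fun hlt => ?_
  set i := topCount F r j
  have hi : i < omega F (j + 1) := hlt.trans_le (card_filter_le _ _)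
  have hmem : (i, j + 1) ∈ μ := by rwa [YoungDiagram.mem_iff_lt_colLen, ← hμ]
  have hi' : i < omega F j := by
    rw [hμ, ← YoungDiagram.mem_iff_lt_colLen]
    exact μ.up_left_mem le_rfl j.le_succ hmem
  have hrow := T.row_weak j.lt_succ_self hmem
  rw [← hT] at hrow
  exact lt_irrefl i ((cp_le_iff hi' r).1 (hrow.trans ((cp_le_iff hi r).2 hlt)))

theorem cp_eq_of_column_eq_image {F : BinArray n} {j c : ℕ} {f : Fin c → Fin n}
    (hf : StrictMono f) (hF : column F j = univ.image f) (i : Fin c) :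
    cp F i j = (f i : ℕ) + 1 := by
  have hcard : #(column F j) = c := by
    rw [hF, card_image_of_injective _ hf.injective, card_univ, Fintype.card_fin]
  have huniq := orderEmbOfFin_unique hcard (f := f)
    (fun l => hF ▸ mem_image_of_mem f (mem_univ l)) hf
  rw [cp_of_lt (hcard.symm ▸ i.2 : (i : ℕ) < #(column F j)), congrFun huniq i]
  exact congrArg (fun a : Fin n => (a : ℕ) + 1) (orderEmbOfFin_eq_orderEmbOfFin_iff.2 rfl)

theorem exists_cp_block_eq {μ : YoungDiagram} (T : Tableaux n μ) :
    ∃ e : Fin n →₀ ℕ, omega (block e) = μ.colLen ∧ cp (block e) = T.1 := by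
  have hentry {i j : ℕ} (h : i < μ.colLen j) : 1 ≤ T.1 i j ∧ T.1 i j ≤ n :=
    T.2 _ _ (YoungDiagram.mem_iff_lt_colLen.2 h)
  let f (j : ℕ) (i : Fin (μ.colLen j)) : Fin n :=
    ⟨T.1 i j - 1, by have := hentry i.2; lia⟩
  have hf (j : ℕ) : StrictMono (f j) := fun i₁ i₂ hi => by
    have := hentry i₁.2
    have := T.1.col_strict hi (YoungDiagram.mem_iff_lt_colLen.2 i₂.2)
    exact Fin.mk_lt_mk.2 (by lia)
  have hcard (j : ℕ) : #(univ.image (f j)) = μ.colLen j := by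
    rw [card_image_of_injective _ (hf j).injective, card_univ, Fintype.card_fin]
  obtain ⟨e, he⟩ := exists_column_block_eq (fun j => univ.image (f j)) (L := μ.rowLen 0)
    fun j hj => by
      rw [← card_eq_zero, hcard]
      refine Nat.eq_zero_of_not_pos fun hpos => hj.not_gt ?_
      rwa [← YoungDiagram.mem_iff_lt_rowLen, YoungDiagram.mem_iff_lt_colLen]
  have homega : omega (block e) = μ.colLen := funext fun j => by rw [omega, he, hcard]
  refine ⟨e, homega, funext₂ fun i j => ?_⟩
  by_cases hi : i < μ.colLen j
  · rw [cp_eq_of_column_eq_image (hf j) (he j) ⟨i, hi⟩]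
    exact Nat.sub_add_cancel (hentry hi).1
  · rw [cp_of_le (homega ▸ not_lt.1 hi), T.1.zeros (by rwa [YoungDiagram.mem_iff_lt_colLen])]

theorem degree_eq_of_omega_block_eq {e e' : Fin n →₀ ℕ} (h : omega (block e) = omega (block e')) :
    e.degree = e'.degree := by
  obtain ⟨L, hL⟩ := exists_omega_block_eq_zero e
  rw [degree_eq_sum_omega hL, degree_eq_sum_omega (h ▸ hL), h]

theorem bijOn_cp {d : ℕ} {μ : YoungDiagram} (hμ : IsDescendingOmega n d μ.colLen)
    (huniq : ∀ w, IsDescendingOmega n d w → w = μ.colLen) :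
    Set.BijOn (fun e : Fin n →₀ ℕ => cp (block e))
      {e | e.degree = d ∧ IsSemistandard (block e)}
      {Y | ∃ T : Tableaux n μ, ∀ i j : ℕ, Y i j = T.1 i j} := by
  refine ⟨?_, (cp_injective.comp block_injective).injOn, ?_⟩
  · rintro e ⟨hd, hss⟩
    have homega : omega (block e) = μ.colLen := huniq _ ⟨hss.antitone_omega, e, hd, rfl⟩
    refine ⟨⟨tableauOfBlock hss homega, fun i j hij => ?_⟩, fun i j => rfl⟩
    rw [YoungDiagram.mem_iff_lt_colLen, ← homega] at hij
    change 1 ≤ cp (block e) i j ∧ cp (block e) i j ≤ n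
    rw [cp_of_lt hij]
    exact ⟨Nat.le_add_left 1 _, Fin.is_lt _⟩
  · rintro Y ⟨T, hT⟩
    obtain ⟨e, homega, hcp⟩ := exists_cp_block_eq T
    obtain ⟨-, e', hd, homega'⟩ := hμ
    exact ⟨e, ⟨(degree_eq_of_omega_block_eq (homega.trans homega'.symm)).trans hd,
      isSemistandard_of_cp_eq homega hcp⟩, hcp.trans (funext₂ fun i j => (hT i j).symm)⟩

/-- A tableau amounts to its function of entries. -/
noncomputable def tableauxEquiv (n : ℕ) (μ : YoungDiagram) :
    Tableaux n μ ≃ {Y : ℕ → ℕ → ℕ | ∃ T : Tableaux n μ, ∀ i j : ℕ, Y i j = T.1 i j} :=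
  Equiv.ofBijective (fun T => ⟨T.1, T, fun _ _ => rfl⟩)
    ⟨fun _ _ h => Subtype.ext (DFunLike.coe_injective (congrArg Subtype.val h)),
      fun ⟨_, T, hT⟩ => ⟨T, Subtype.ext (funext₂ fun i j => (hT i j).symm)⟩⟩

end HitProblem

theorem theorem3p15 (n d : ℕ) :
    (HitProblem.IsRowRegular n d → ∃! w : ℕ → ℕ, HitProblem.IsDescendingOmega n d w) ∧
    ((∃! w : ℕ → ℕ, HitProblem.IsDescendingOmega n d w) →
      Submodule.span (ZMod 2)
          {q : HitProblem.Cohits n d | ∃ (e : Fin n →₀ ℕ) (he : e.degree = d),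
            HitProblem.IsSemistandard (HitProblem.block e) ∧
              q = HitProblem.monomialClass e he} = ⊤ ∧
      ∃ μ : YoungDiagram, HitProblem.IsDescendingOmega n d μ.colLen ∧
        Set.BijOn (fun e : Fin n →₀ ℕ => HitProblem.cp (HitProblem.block e))
          {e | e.degree = d ∧ HitProblem.IsSemistandard (HitProblem.block e)}
          {Y | ∃ T : HitProblem.Tableaux n μ, ∀ i j : ℕ, Y i j = T.1 i j} ∧
        Finite (HitProblem.Tableaux n μ) ∧
        Module.rank (ZMod 2) (HitProblem.Cohits n d) ≤
          (Nat.card (HitProblem.Tableaux n μ) : Cardinal)) := by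
  refine ⟨HitProblem.existsUnique_isDescendingOmega_of_isRowRegular, fun hunique => ?_⟩
  have hspan := HitProblem.span_monomialClass_eq_top
    (HitProblem.homog_le_hits_sup_semistandard hunique)
  obtain ⟨w, hw, huniq⟩ := hunique
  obtain ⟨μ, rfl⟩ : ∃ μ : YoungDiagram, μ.colLen = w := by
    obtain ⟨hanti, e, -, rfl⟩ := hw
    obtain ⟨L, hL⟩ := HitProblem.exists_omega_block_eq_zero e
    exact HitProblem.exists_youngDiagram_colLen_eq hanti hL
  have hbij := HitProblem.bijOn_cp hw huniq
  have hequiv := (Set.BijOn.equiv _ hbij).trans (HitProblem.tableauxEquiv n μ).symm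
  have hfinite : Finite {e : Fin n →₀ ℕ | e.degree = d ∧
      HitProblem.IsSemistandard (HitProblem.block e)} :=
    ((Finsupp.finite_of_degree_eq d).subset fun _ he => he.1).to_subtype
  have hfiniteT : Finite (HitProblem.Tableaux n μ) := Finite.of_equiv _ hequiv
  refine ⟨hspan, μ, hw, hbij, hfiniteT, (HitProblem.rank_cohits_le hspan).trans_eq ?_⟩
  rw [Nat.cast_card, Cardinal.mk_congr hequiv]
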